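/- **Theorem (Matui's spatial realization theorem).** All inverse monoids below have a zero; the order is the natural partial order ($a\le b$ iff $a=ba^{-1}a$), and joins and meets are taken with respect to it. Elements $a,b$ are *compatible* if $a^{-1}b$ and $ab^{-1}$ are idempotents. An inverse monoid is *Boolean* if its idempotents form a Boolean algebra (with complement $e\mapsto\bar e$), any two compatible elements have a join, and multiplication distributes over such binary joins on both sides. A *Tarski monoid* is a countably infinite Boolean inverse monoid in which any two elements have a meet. A Tarski monoid $S$ is *simple* if it is fundamental (every element commuting with all idempotents is itself an idempotent) and $0$-simplifying (the only two-sided ideals of $S$ closed under joins of finite compatible subsets are $\{0\}$ and $S$). Let $\mathsf U(S)$ be the group of units of $S$. A *special involution* of $S$ is a unit of the form $$a^{-1}\vee a\vee\overline{a^{-1}a\vee aa^{-1}},\qquad a\in S,\ a\neq 0,\ a^2=0,$$ and $\mathsf{Sym}(S)$ is the subgroup of $\mathsf U(S)$ generated by the special involutions. Let $S$ and $T$ be simple Tarski monoids. Then the following are equivalent: 1. the monoids $S$ and $T$ are isomorphic; 2. the groups $\mathsf U(S)$ and $\mathsf U(T)$ are isomorphic; 3. the groups $\mathsf{Sym}(S)$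 and $\mathsf{Sym}(T)$ are isomorphic. -/

import Mathlib

universe u v

/-- An inverse monoid with zero: every element `s` has a unique (generalized) inverse `s⁻¹`. -/
class InverseMonoidWithZero (S : Type u) extends MonoidWithZero S, Inv S where
  mul_inv_mul : ∀ s : S, s * s⁻¹ * s = s
  inv_mul_inv : ∀ s : S, s⁻¹ * s * s⁻¹ = s⁻¹
  inv_unique : ∀ s t : S, s * t * s = s → t * s * t = t → t = s⁻¹

namespace InverseMonoidWithZero

section Basic

variable {S : Type u} [InverseMonoidWithZero S]

theorem idem_mul {e f : S} (he : e * e = e) (hf : f * f = f) :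
    (e * f) * (e * f) = e * f := by
  have h1 := mul_inv_mul (e * f)
  have h2 := inv_mul_inv (e * f)
  generalize hx : (e * f)⁻¹ = x at h1 h2
  have h3 : f * x * e = x := by
    rw [← hx]
    apply inv_unique
    · rw [hx]
      calc e * f * (f * x * e) * (e * f) = e * (f * f) * x * (e * e) * f := by
            simp only [mul_assoc]
        _ = e * f * x * (e * f) := by rw [hf, he]; simp only [mul_assoc]
        _ = e * f := h1
    · rw [hx]
      calc f * x * e * (e * f) * (f * x * e) = f * (x * ((e * e) * (f * f)) * x) * e := by
            simp only [mul_assoc]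
        _ = f * x * e := by rw [hf, he, h2]
  have h4 : x * x = x := by
    calc x * x = (f * x * e) * (f * x * e) := by rw [h3]
      _ = f * (x * (e * f) * x) * e := by simp only [mul_assoc]
      _ = x := by rw [h2, h3]
  have h5 : e * f = x⁻¹ := inv_unique x (e * f) h2 h1
  have h6 : x = x⁻¹ := inv_unique x x (by rw [h4, h4]) (by rw [h4, h4])
  rw [h5, ← h6, h4]

theorem idem_comm {e f : S} (he : e * e = e) (hf : f * f = f) : e * f = f * e := by
  have h1 := idem_mul he hf
  have h2 := idem_mul hf he
  have h3 : f * e = (e * f)⁻¹ := by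
    apply inv_unique
    · calc e * f * (f * e) * (e * f) = e * (f * f) * (e * e) * f := by simp only [mul_assoc]
        _ = (e * f) * (e * f) := by rw [he, hf]; simp only [mul_assoc]
        _ = e * f := h1
    · calc f * e * (e * f) * (f * e) = f * (e * e) * (f * f) * e := by simp only [mul_assoc]
        _ = (f * e) * (f * e) := by rw [he, hf]; simp only [mul_assoc]
        _ = f * e := h2
  have h4 : e * f = (e * f)⁻¹ := inv_unique _ _ (by rw [h1, h1]) (by rw [h1, h1])
  rw [h3, ← h4]

theorem dom_idem (s : S) : (s⁻¹ * s) * (s⁻¹ * s) = s⁻¹ * s := by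
  rw [← mul_assoc, inv_mul_inv]

/-- The natural partial order: `a ≤ b` if and only if `a = b * a⁻¹ * a`. -/
instance : PartialOrder S where
  le a b := a = b * a⁻¹ * a
  le_refl a := (mul_inv_mul a).symm
  le_trans a b c hab hbc := by
    change a = b * a⁻¹ * a at hab
    change b = c * b⁻¹ * b at hbc
    have ha := dom_idem a
    have hb := dom_idem b
    have hbb : b * (b⁻¹ * b) = b := by rw [← mul_assoc, mul_inv_mul]
    have hab' : a = b * (a⁻¹ * a) := by rw [← mul_assoc]; exact hab
    have hbc' : b = c * (b⁻¹ * b) := by rw [← mul_assoc]; exact hbc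
    have hfix : a * (b⁻¹ * b) = a := by
      calc a * (b⁻¹ * b) = b * (a⁻¹ * a) * (b⁻¹ * b) := by rw [← hab']
        _ = b * ((b⁻¹ * b) * (a⁻¹ * a)) := by rw [mul_assoc, idem_comm ha hb]
        _ = a := by rw [← mul_assoc, hbb, ← hab']
    calc a = b * (a⁻¹ * a) := hab'
      _ = c * (b⁻¹ * b) * (a⁻¹ * a) := by rw [← hbc']
      _ = c * ((a⁻¹ * a) * (b⁻¹ * b)) := by rw [mul_assoc, idem_comm hb ha]
      _ = c * (a⁻¹ * (a * (b⁻¹ * b))) := by simp only [mul_assoc]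
      _ = c * a⁻¹ * a := by rw [hfix, mul_assoc]
  le_antisymm a b hab hba := by
    change a = b * a⁻¹ * a at hab
    change b = a * b⁻¹ * b at hba
    have ha := dom_idem a
    have hb := dom_idem b
    rw [mul_assoc] at hab hba
    calc a = b * (a⁻¹ * a) := hab
      _ = a * (b⁻¹ * b) * (a⁻¹ * a) := by rw [← hba]
      _ = a * ((a⁻¹ * a) * (b⁻¹ * b)) := by rw [mul_assoc, idem_comm hb ha]
      _ = a * (b⁻¹ * b) := by rw [← mul_assoc, ← mul_assoc a, mul_inv_mul]
      _ = b := hba.symm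

end Basic

section Definitions

variable {S : Type u} [InverseMonoidWithZero S]

/-- The compatibility relation. -/
def Compatible (s t : S) : Prop :=
  IsIdempotentElem (s⁻¹ * t) ∧ IsIdempotentElem (s * t⁻¹)

/-- The set of all joins (in the natural partial order) of finite compatible subsets of `X`. -/
def joinClosure (X : Set S) : Set S :=
  {c | ∃ F : Set S, F.Finite ∧ F ⊆ X ∧ F.Pairwise Compatible ∧ IsLUB F c}

/-- `f` is the complement of the idempotent `e` in the Boolean algebra of idempotents. -/
def IsComplement (e f : S) : Prop :=
  IsIdempotentElem f ∧ e * f = 0 ∧ IsLUB {e, f} 1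

/-- `x` is the extent of `a`, the join of its domain and its range idempotents. -/
def IsExtent (a x : S) : Prop :=
  IsLUB {a⁻¹ * a, a * a⁻¹} x

/-- A special involution is a unit which is the join of `a⁻¹`, `a` and the complement of the
extent of `a`, where `a` is a nonzero element with `a ^ 2 = 0`. -/
def IsSpecialInvolution (g : Sˣ) : Prop :=
  ∃ a x f : S, a ≠ 0 ∧ a ^ 2 = 0 ∧ IsExtent a x ∧ IsComplement x f ∧
    IsLUB {a⁻¹, a, f} (g : S)

variable (S)

/-- The symmetric group of `S`: the subgroup of the group of units generated by the special
involutions. -/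
def Sym : Subgroup Sˣ :=
  Subgroup.closure {g : Sˣ | IsSpecialInvolution g}

end Definitions

end InverseMonoidWithZero

open InverseMonoidWithZero in
/-- Boolean inverse monoids. -/
class IsBooleanInverseMonoid (S : Type u) [InverseMonoidWithZero S] : Prop where
  /-- The idempotents, under the natural partial order, form a Boolean algebra. -/
  idempotents_boolean : ∃ (B : Type u) (_ : BooleanAlgebra B),
    Nonempty (B ≃o {e : S // IsIdempotentElem e})
  /-- Binary compatible joins exist. -/
  exists_join : ∀ a b : S, Compatible a b → ∃ c : S, IsLUB {a, b} c
  /-- Multiplication distributes over binary compatible joins on both sides. -/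
  mul_join : ∀ s a b c : S, Compatible a b → IsLUB {a, b} c → IsLUB {s * a, s * b} (s * c)
  join_mul : ∀ s a b c : S, Compatible a b → IsLUB {a, b} c → IsLUB {a * s, b * s} (c * s)

/-- A Tarski monoid is a countably infinite Boolean inverse monoid in which every two elements
have a meet. -/
class IsTarskiMonoid (S : Type u) [InverseMonoidWithZero S] : Prop
    extends IsBooleanInverseMonoid S where
  countable : Countable S
  infinite : Infinite S
  exists_meet : ∀ a b : S, ∃ c : S, IsGLB {a, b} c

/-- Fundamental: only idempotents centralize the set of idempotents. -/
def IsFundamental (S : Type u) [InverseMonoidWithZero S] : Prop :=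
  ∀ a : S, (∀ e : S, IsIdempotentElem e → a * e = e * a) → IsIdempotentElem a

/-- `0`-simplifying: there are no `∨`-closed two-sided ideals other than `{0}` and `S`. -/
def IsZeroSimplifying (S : Type u) [InverseMonoidWithZero S] : Prop :=
  ∀ I : Set S, I.Nonempty → (∀ s : S, ∀ x ∈ I, s * x ∈ I ∧ x * s ∈ I) →
    InverseMonoidWithZero.joinClosure I = I → I = {0} ∨ I = Set.univ

/-- A simple Tarski monoid is one that is fundamental and `0`-simplifying. -/
class IsSimpleTarskiMonoid (S : Type u) [InverseMonoidWithZero S] : Prop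
    extends IsTarskiMonoid S where
  fundamental : IsFundamental S
  zero_simplifying : IsZeroSimplifying S

/-! The proof is a reconstruction argument: a group acting on a Boolean algebra with enough
involutions remembers the algebra. Let `G` be any group embedded in the units with image containing
`Sym S`, so that both groups of the theorem are covered. It acts faithfully by conjugation on the
Boolean algebra of idempotents, and meets with `1` give each unit a support. For an involution `τ`,
the elements supported below the support of `τ` are definable inside the group alone
(`mem_supportCentralizer_iff`), so a group isomorphism preserves inclusions between supports of
involutions. Every idempotent is a finite join of such supports, whence an equivariant isomorphism
`α` of the algebras (`exists_equivariant_orderIso`).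

To return to the monoids: an element of a fundamental monoid is determined by its action on
idempotents (`eq_of_conj_eq`). Every element is built from idempotents and elements of square zero
by products and compatible joins (`mem_of_closed`), and a nonzero element of square zero is a
special involution cut down to its domain. Hence each `s : S` has exactly one counterpart in `T`
acting in the same way through `α`, and this correspondence is the isomorphism.

The condition of being `0`-simplifying acts as minimality (`exists_dom_notMem`): a point of the
Stone space, given as a prime ideal, can be moved into any nonzero idempotent. With infinitude this
rules out atoms and yields elements of square zero near every point. Compactness takes the form of
extending a proper ideal to a prime one. -/

/-- A faithful action of a group on a Boolean algebra in which every group element has a support,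
and which is rich in involutions. -/
structure SupportedAction (G B : Type*) [Group G] [BooleanAlgebra B] where
  act : G →* (B ≃o B)
  supp : G → B
  injective : Function.Injective act
  act_eq_self : ∀ {g : G} {b : B}, Disjoint b (supp g) → act g b = b
  exists_disjoint : ∀ {g : G} {b : B}, ¬ Disjoint b (supp g) →
    ∃ c ≤ b, c ≠ ⊥ ∧ Disjoint (act g c) c
  exists_sq_ne_one : ∀ {b : B}, b ≠ ⊥ → ∃ g, supp g ≤ b ∧ g * g ≠ 1
  exists_restrict : ∀ {τ : G} {a : B}, τ * τ = 1 → Disjoint (act τ a) a →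
    ∃ σ, (∀ c ≤ a ⊔ act τ a, act σ c = act τ c) ∧
      ∀ c, Disjoint c (a ⊔ act τ a) → act σ c = c
  exists_sup_supp : ∀ b : B, ∃ F : Finset G, (∀ τ ∈ F, τ * τ = 1) ∧ F.sup supp = b

/-! ### Group-theoretic encoding of supports -/

section GroupTheory

variable {G H : Type*} [Group G] [Group H]

/-- The involutions centralizing `τ` that commute with all their conjugates under the centralizer
of `τ`. -/
def involutionHull (τ : G) : Set G :=
  {φ | Commute φ τ ∧ φ * φ = 1 ∧ ∀ ψ, Commute ψ τ → Commute φ (ψ * φ * ψ⁻¹)}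

/-- The centralizer of the squares of the elements centralizing `involutionHull τ`. For an
involution `τ` of a `SupportedAction`, these are the elements supported below `τ`. -/
def supportCentralizer (τ : G) : Set G :=
  {φ | ∀ ψ, (∀ υ ∈ involutionHull τ, Commute ψ υ) → Commute φ (ψ * ψ)}

theorem map_mem_involutionHull (f : G ≃* H) {τ φ : G} (h : φ ∈ involutionHull τ) :
    f φ ∈ involutionHull (f τ) := by
  obtain ⟨h1, h2, h3⟩ := h
  refine ⟨h1.map f, by rw [← map_mul, h2, map_one], fun ψ hψ => ?_⟩
  have := (h3 (f.symm ψ) (by simpa using hψ.map f.symm)).map f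
  simpa using this

theorem map_mem_supportCentralizer (f : G ≃* H) {τ φ : G} (h : φ ∈ supportCentralizer τ) :
    f φ ∈ supportCentralizer (f τ) := by
  intro ψ hψ
  have := (h (f.symm ψ) fun υ hυ => by
    simpa using (hψ _ (map_mem_involutionHull f hυ)).map f.symm).map f
  simpa using this

theorem map_mem_supportCentralizer_iff (f : G ≃* H) {τ φ : G} :
    f φ ∈ supportCentralizer (f τ) ↔ φ ∈ supportCentralizer τ :=
  ⟨fun h => by simpa using map_mem_supportCentralizer f.symm h, map_mem_supportCentralizer f⟩

end GroupTheory

/-! ### Supports, restrictions of involutions and the centralizer characterization -/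

namespace SupportedAction

variable {G B : Type*} [Group G] [BooleanAlgebra B] (A : SupportedAction G B)

theorem act_mul (g h : G) (b : B) : A.act (g * h) b = A.act g (A.act h b) := by
  rw [map_mul]; rfl

@[simp] theorem act_one (b : B) : A.act 1 b = b := by
  rw [map_one]; rfl

@[simp] theorem act_inv_act (g : G) (b : B) : A.act g⁻¹ (A.act g b) = b := by
  rw [← act_mul]; simp

@[simp] theorem act_act_inv (g : G) (b : B) : A.act g (A.act g⁻¹ b) = b := by
  rw [← act_mul]; simp

theorem act_ne_bot {g : G} {b : B} (hb : b ≠ ⊥) : A.act g b ≠ ⊥ := by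
  simpa using hb

theorem disjoint_act_iff {g : G} {b c : B} :
    Disjoint (A.act g b) (A.act g c) ↔ Disjoint b c := by
  simp only [disjoint_iff, ← map_inf, map_eq_bot_iff]

theorem disjoint_act_inv_iff {g : G} {b c : B} :
    Disjoint (A.act g⁻¹ b) c ↔ Disjoint b (A.act g c) := by
  rw [← A.disjoint_act_iff (g := g), act_act_inv]

theorem disjoint_supp_iff {g : G} {b : B} :
    Disjoint b (A.supp g) ↔ ∀ c ≤ b, A.act g c = c := by
  refine ⟨fun h c hc => A.act_eq_self (h.mono_left hc), fun h => ?_⟩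
  by_contra hd
  obtain ⟨c, hcb, hc, hdc⟩ := A.exists_disjoint hd
  rw [h c hcb, disjoint_self] at hdc
  exact hc hdc

theorem supp_le_iff {g : G} {b : B} :
    A.supp g ≤ b ↔ ∀ c, Disjoint c b → A.act g c = c := by
  rw [← disjoint_compl_left_iff, disjoint_supp_iff]
  simp only [le_compl_iff_disjoint_right]

theorem supp_conj (h g : G) : A.supp (h * g * h⁻¹) = A.act h (A.supp g) := by
  have key : ∀ b, Disjoint b (A.supp (h * g * h⁻¹)) ↔ Disjoint b (A.act h (A.supp g)) := by
    intro b
    rw [disjoint_supp_iff, ← disjoint_act_inv_iff, disjoint_supp_iff]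
    constructor
    · intro H c hc
      have := H (A.act h c) (by simpa using (A.act h).monotone hc)
      rw [act_mul, act_mul, act_inv_act] at this
      exact (A.act h).injective this
    · intro H c hc
      rw [act_mul, act_mul, H _ ((A.act h⁻¹).monotone hc), act_act_inv]
  apply le_antisymm
  · rw [← disjoint_compl_left_iff, key]; exact disjoint_compl_left
  · rw [← disjoint_compl_left_iff, ← key]; exact disjoint_compl_left

theorem act_supp_of_commute {g h : G} (hc : Commute g h) : A.act h (A.supp g) = A.supp g := by
  rw [← supp_conj, ← hc.eq, mul_inv_cancel_right]

theorem eq_of_act_eq {g h : G} (b : B) (h₁ : ∀ c ≤ b, A.act g c = A.act h c)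
    (h₂ : ∀ c ≤ bᶜ, A.act g c = A.act h c) : g = h := by
  apply A.injective
  ext c
  rw [← sup_inf_inf_compl (x := c) (y := b), map_sup, map_sup, h₁ _ inf_le_right,
    h₂ _ inf_le_right]

theorem commute_of_disjoint {g h : G} (hd : Disjoint (A.supp g) (A.supp h)) : Commute g h := by
  have hh : A.act h (A.supp g) = A.supp g := A.act_eq_self hd
  have hg : A.act g (A.supp g) = A.supp g := A.act_supp_of_commute (Commute.refl g)
  refine A.eq_of_act_eq (A.supp g) (fun c hc => ?_) fun c hc => ?_
  · have : A.act g c ≤ A.supp g := by rw [← hg]; exact (A.act g).monotone hc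
    rw [act_mul, act_mul, A.act_eq_self (hd.mono_left hc), A.act_eq_self (hd.mono_left this)]
  · have : A.act h c ≤ (A.supp g)ᶜ := by
      conv_rhs => rw [← hh, ← map_compl']
      exact (A.act h).monotone hc
    rw [act_mul, act_mul, A.act_eq_self (le_compl_iff_disjoint_right.1 hc),
      A.act_eq_self (le_compl_iff_disjoint_right.1 this)]

theorem act_act_of_sq {τ : G} (hτ : τ * τ = 1) (b : B) : A.act τ (A.act τ b) = b := by
  rw [← act_mul, hτ, act_one]

/-- The element `σ` acts as `τ` below `h` and trivially off `h`. -/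
def IsRestriction (τ σ : G) (h : B) : Prop :=
  A.act τ h = h ∧ (∀ c ≤ h, A.act σ c = A.act τ c) ∧ ∀ c ≤ hᶜ, A.act σ c = c

variable {A}

theorem IsRestriction.conj {τ σ ψ : G} {h : B} (H : A.IsRestriction τ σ h) (hψ : Commute ψ τ) :
    A.IsRestriction τ (ψ * σ * ψ⁻¹) (A.act ψ h) := by
  obtain ⟨h1, h2, h3⟩ := H
  refine ⟨?_, fun c hc => ?_, fun c hc => ?_⟩
  · rw [← act_mul, ← hψ.eq, act_mul, h1]
  · have : A.act ψ⁻¹ c ≤ h := by simpa using (A.act ψ⁻¹).monotone hc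
    rw [act_mul, act_mul, h2 _ this, ← act_mul, ← act_mul, hψ.eq, mul_inv_cancel_right]
  · have : A.act ψ⁻¹ c ≤ hᶜ := by
      rw [← map_compl'] at hc
      simpa using (A.act ψ⁻¹).monotone hc
    rw [act_mul, act_mul, h3 _ this, act_act_inv]

/-- Both `h` and `k` are invariant under `τ`. On each of the four pieces that they cut out, `σ` and
`ρ` each act as `τ` or as the identity. -/
theorem IsRestriction.commute {τ σ ρ : G} {h k : B} (H : A.IsRestriction τ σ h)
    (K : A.IsRestriction τ ρ k) : Commute σ ρ := by
  obtain ⟨h1, h2, h3⟩ := H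
  obtain ⟨k1, k2, k3⟩ := K
  have hm : ∀ c ≤ h, A.act τ c ≤ h := fun c hc => h1 ▸ (A.act τ).monotone hc
  have km : ∀ c ≤ k, A.act τ c ≤ k := fun c hc => k1 ▸ (A.act τ).monotone hc
  have h1' : A.act τ hᶜ = hᶜ := by rw [map_compl', h1]
  have k1' : A.act τ kᶜ = kᶜ := by rw [map_compl', k1]
  have hm' : ∀ c ≤ hᶜ, A.act τ c ≤ hᶜ := fun c hc => h1' ▸ (A.act τ).monotone hc
  have km' : ∀ c ≤ kᶜ, A.act τ c ≤ kᶜ := fun c hc => k1' ▸ (A.act τ).monotone hc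
  have split : ∀ c, A.act (σ * ρ) (c ⊓ k) = A.act (ρ * σ) (c ⊓ k) →
      A.act (σ * ρ) (c ⊓ kᶜ) = A.act (ρ * σ) (c ⊓ kᶜ) →
      A.act (σ * ρ) c = A.act (ρ * σ) c := by
    intro c e1 e2
    rw [← sup_inf_inf_compl (x := c) (y := k), map_sup, map_sup, e1, e2]
  refine A.eq_of_act_eq h (fun c hc => split c ?_ ?_) fun c hc => split c ?_ ?_ <;>
    simp only [act_mul]
  · have a1 : c ⊓ k ≤ h := inf_le_left.trans hc
    have a2 : c ⊓ k ≤ k := inf_le_right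
    rw [k2 _ a2, h2 _ a1, h2 _ (hm _ a1), k2 _ (km _ a2)]
  · have a1 : c ⊓ kᶜ ≤ h := inf_le_left.trans hc
    have a2 : c ⊓ kᶜ ≤ kᶜ := inf_le_right
    rw [k3 _ a2, h2 _ a1, k3 _ (km' _ a2)]
  · have a1 : c ⊓ k ≤ hᶜ := inf_le_left.trans hc
    have a2 : c ⊓ k ≤ k := inf_le_right
    rw [k2 _ a2, h3 _ a1, h3 _ (hm' _ a1), k2 _ a2]
  · have a1 : c ⊓ kᶜ ≤ hᶜ := inf_le_left.trans hc
    have a2 : c ⊓ kᶜ ≤ kᶜ := inf_le_right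
    rw [k3 _ a2, h3 _ a1, k3 _ a2]

/-- Conjugating a restriction of `τ` by an element centralizing `τ` gives another restriction of
`τ`, and all restrictions of `τ` commute. -/
theorem IsRestriction.mem_involutionHull {τ σ : G} {h : B} (hτ : τ * τ = 1)
    (H : A.IsRestriction τ σ h) : σ ∈ involutionHull τ := by
  have T : A.IsRestriction τ τ ⊤ := ⟨map_top _, fun _ _ => rfl, fun c hc => by
    rw [compl_top, le_bot_iff] at hc; rw [hc, map_bot]⟩
  refine ⟨H.commute T, ?_, fun ψ hψ => H.commute (H.conj hψ)⟩
  obtain ⟨h1, h2, h3⟩ := H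
  refine A.eq_of_act_eq h (fun c hc => ?_) fun c hc => ?_
  · have : A.act τ c ≤ h := h1 ▸ (A.act τ).monotone hc
    rw [act_mul, h2 _ hc, h2 _ this, A.act_act_of_sq hτ, act_one]
  · rw [act_mul, h3 _ hc, h3 _ hc, act_one]

variable (A)

theorem exists_isRestriction {τ : G} {a : B} (hτ : τ * τ = 1) (ha : Disjoint (A.act τ a) a) :
    ∃ σ, A.IsRestriction τ σ (a ⊔ A.act τ a) ∧ A.supp σ = a ⊔ A.act τ a := by
  obtain ⟨σ, h1, h2⟩ := A.exists_restrict hτ ha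
  have h2' : ∀ c ≤ (a ⊔ A.act τ a)ᶜ, A.act σ c = c :=
    fun c hc => h2 c (le_compl_iff_disjoint_right.1 hc)
  refine ⟨σ, ⟨by rw [map_sup, A.act_act_of_sq hτ, sup_comm], h1, h2'⟩, le_antisymm ?_ ?_⟩
  · rw [supp_le_iff]; exact h2
  -- The part of `x` outside the support of `σ` is fixed by `τ` and also moved off itself by `τ`, so
  -- it is zero.
  · have key : ∀ x, x ≤ a ⊔ A.act τ a → Disjoint (A.act τ x) x → x ≤ A.supp σ := by
      intro x hx hdx
      rw [← disjoint_compl_right_iff]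
      have e := A.act_eq_self (g := σ) (b := x ⊓ (A.supp σ)ᶜ)
        (disjoint_compl_left.mono_left inf_le_right)
      rw [h1 _ (inf_le_left.trans hx)] at e
      have hd : Disjoint (A.act τ (x ⊓ (A.supp σ)ᶜ)) (x ⊓ (A.supp σ)ᶜ) :=
        hdx.mono ((A.act τ).monotone inf_le_left) inf_le_left
      rw [e, disjoint_self] at hd
      exact disjoint_iff.2 hd
    refine sup_le (key _ le_sup_left ha) (key _ le_sup_right ?_)
    rw [A.act_act_of_sq hτ]; exact ha.symm

/-- Otherwise `φ` moves some nonzero `b`, disjoint from the support of `τ`, off itself. Take `ψ`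
supported in `b` with nontrivial square; it centralizes `τ`. That `φ` commutes with `ψ * φ * ψ⁻¹`
forces `ψ` and `φ * ψ * φ⁻¹` to have equal squares, although their supports are disjoint. -/
theorem supp_le_of_mem_involutionHull {τ φ : G} (h : φ ∈ involutionHull τ) :
    A.supp φ ≤ A.supp τ := by
  obtain ⟨h1, h2, h3⟩ := h
  by_contra hle
  rw [← disjoint_compl_left_iff] at hle
  obtain ⟨b, hb, hb0, hd⟩ := A.exists_disjoint hle
  obtain ⟨ψ, hψ, hψ2⟩ := A.exists_sq_ne_one hb0
  have hbτ : Disjoint b (A.supp τ) := le_compl_iff_disjoint_right.1 hb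
  have e := (h3 ψ (A.commute_of_disjoint (hbτ.mono_left hψ))).eq
  have hφ : φ⁻¹ = φ := inv_eq_of_mul_eq_one_left h2
  apply hψ2
  have hs : A.supp (φ * ψ * φ⁻¹) ≤ A.act φ b := by
    rw [supp_conj]; exact (A.act φ).monotone hψ
  have hs' : A.supp (φ * ψ⁻¹ * φ⁻¹) ≤ A.act φ b := by
    rw [supp_le_iff] at hs ⊢
    intro c hc
    have := congrArg (A.act (φ * ψ⁻¹ * φ⁻¹)) (hs c hc)
    rw [← act_mul] at this
    simpa [mul_assoc] using this.symm
  have key : ψ * (φ * ψ⁻¹ * φ⁻¹) = (φ * ψ * φ⁻¹) * ψ⁻¹ := by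
    rw [hφ]
    calc ψ * (φ * ψ⁻¹ * φ) = (ψ * φ * ψ⁻¹) * φ := by group
      _ = φ * (ψ * φ * ψ⁻¹) := e.symm
      _ = φ * ψ * φ * ψ⁻¹ := by group
  have hψψ : ψ * ψ = (φ * ψ * φ⁻¹) * (φ * ψ * φ⁻¹) := by
    have hc : Commute ψ (φ * ψ * φ⁻¹) := A.commute_of_disjoint (hd.symm.mono hψ hs)
    calc ψ * ψ = ψ * (φ * ψ⁻¹ * φ⁻¹) * (φ * ψ * φ⁻¹) * ψ := by group
      _ = (φ * ψ * φ⁻¹) * ψ⁻¹ * ((φ * ψ * φ⁻¹) * ψ) := by rw [key]; group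
      _ = (φ * ψ * φ⁻¹) * ψ⁻¹ * (ψ * (φ * ψ * φ⁻¹)) := by rw [hc.eq]
      _ = _ := by group
  refine A.eq_of_act_eq b (fun c hc => ?_) fun c hc => ?_
  · rw [hψψ, act_mul]
    have : A.act (φ * ψ * φ⁻¹) c = c := A.act_eq_self (hd.symm.mono hc hs)
    rw [this, this, act_one]
  · have : A.act ψ c = c := A.supp_le_iff.1 hψ c (le_compl_iff_disjoint_right.1 hc)
    rw [act_mul, this, this, act_one]

/-- Otherwise some nonzero `c` below the support of `τ` is moved off itself by `φ * φ`, by `φ` and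
by `τ`. Since `φ` commutes with the restriction of `τ` to `c ⊔ τ c`, it preserves this join, hence
maps `c` into `τ c`. As `φ` also commutes with `τ`, its square maps `c` into `c`, a contradiction.
-/
theorem disjoint_supp_sq {τ φ : G} (hτ : τ * τ = 1)
    (h : ∀ υ ∈ involutionHull τ, Commute φ υ) : Disjoint (A.supp τ) (A.supp (φ * φ)) := by
  by_contra hd
  obtain ⟨c₁, hc₁, hc₁0, hd₁⟩ := A.exists_disjoint hd
  have hφ : ¬ Disjoint c₁ (A.supp φ) := by
    intro H
    have e := A.act_eq_self H
    rw [act_mul, e, e, disjoint_self] at hd₁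
    exact hc₁0 hd₁
  obtain ⟨c₂, hc₂, hc₂0, hd₂⟩ := A.exists_disjoint hφ
  have hτ' : ¬ Disjoint c₂ (A.supp τ) := fun H =>
    hc₂0 (disjoint_self.1 (H.mono_right (hc₂.trans hc₁)))
  obtain ⟨c, hc, hc0, hd₃⟩ := A.exists_disjoint hτ'
  obtain ⟨σ, hσ, hsσ⟩ := A.exists_isRestriction hτ hd₃
  have hφσ := A.act_supp_of_commute (h σ (hσ.mem_involutionHull hτ)).symm
  have T : A.IsRestriction τ τ ⊤ := ⟨map_top _, fun _ _ => rfl, fun c hc => by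
    rw [compl_top, le_bot_iff] at hc; rw [hc, map_bot]⟩
  have hφτ : Commute φ τ := h τ (T.mem_involutionHull hτ)
  have h1 : A.act φ c ≤ A.act τ c := by
    have : A.act φ c ≤ c ⊔ A.act τ c := by
      rw [← hsσ, ← hφσ, hsσ]; exact (A.act φ).monotone le_sup_left
    have hdc : Disjoint (A.act φ c) c := hd₂.mono ((A.act φ).monotone hc) hc
    exact hdc.left_le_of_le_sup_left this
  have h2 : A.act (φ * φ) c ≤ c := by
    calc A.act (φ * φ) c = A.act φ (A.act φ c) := A.act_mul _ _ _
      _ ≤ A.act φ (A.act τ c) := (A.act φ).monotone h1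
      _ = A.act τ (A.act φ c) := by rw [← act_mul, ← act_mul, hφτ.eq]
      _ ≤ A.act τ (A.act τ c) := (A.act τ).monotone h1
      _ = c := A.act_act_of_sq hτ c
  have h3 : Disjoint (A.act (φ * φ) c) c :=
    hd₁.mono ((A.act (φ * φ)).monotone (hc.trans hc₂)) (hc.trans hc₂)
  exact A.act_ne_bot hc0 (disjoint_self.1 (h3.mono_right h2))

/-- If `φ` moves a nonzero `b` off the support of `τ` to something disjoint from `b`, an element `ψ`
supported in `b` commutes with the whole hull, so `φ` must preserve the nonzero support of `ψ * ψ`,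
which lies in `b`. The converse is commutation of elements with disjoint supports. -/
theorem mem_supportCentralizer_iff {τ φ : G} (hτ : τ * τ = 1) :
    φ ∈ supportCentralizer τ ↔ A.supp φ ≤ A.supp τ := by
  constructor
  · intro h
    by_contra hle
    rw [← disjoint_compl_left_iff] at hle
    obtain ⟨b, hb, hb0, hd⟩ := A.exists_disjoint hle
    obtain ⟨ψ, hψ, hψ2⟩ := A.exists_sq_ne_one hb0
    have hbτ : Disjoint b (A.supp τ) := le_compl_iff_disjoint_right.1 hb
    have hc := h ψ fun υ hυ => A.commute_of_disjoint
      (hbτ.mono hψ (A.supp_le_of_mem_involutionHull hυ))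
    have hs := A.act_supp_of_commute hc.symm
    have hle : A.supp (ψ * ψ) ≤ b := by
      rw [supp_le_iff] at hψ ⊢
      intro c hcb
      rw [act_mul, hψ c hcb, hψ c hcb]
    have h0 : Disjoint (A.supp (ψ * ψ)) (A.supp (ψ * ψ)) := by
      conv_lhs => rw [← hs]
      exact hd.mono ((A.act φ).monotone hle) hle
    rw [disjoint_self] at h0
    apply hψ2
    refine A.eq_of_act_eq ⊤ (fun c _ => ?_) fun c hc' => ?_
    · rw [act_one, A.act_eq_self (by rw [h0]; exact disjoint_bot_right)]
    · rw [act_one, A.act_eq_self (by rw [h0]; exact disjoint_bot_right)]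
  · intro h ψ hψ
    exact A.commute_of_disjoint ((A.disjoint_supp_sq hτ hψ).mono_left h)

theorem supp_eq_bot_iff {g : G} : A.supp g = ⊥ ↔ g = 1 := by
  constructor
  · intro h
    refine A.eq_of_act_eq ⊤ (fun c _ => ?_) fun c _ => ?_ <;>
      rw [act_one, A.act_eq_self (by rw [h]; exact disjoint_bot_right)]
  · rintro rfl
    rw [← le_bot_iff, supp_le_iff]
    simp

theorem exists_involution {b : B} (hb : b ≠ ⊥) : ∃ τ, τ * τ = 1 ∧ τ ≠ 1 ∧ A.supp τ ≤ b := by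
  obtain ⟨F, hF, hs⟩ := A.exists_sup_supp b
  by_contra! H
  apply hb
  rw [← hs, Finset.sup_eq_bot_iff]
  intro τ hτ
  rw [supp_eq_bot_iff]
  by_contra h1
  exact H τ (hF τ hτ) h1 (hs ▸ Finset.le_sup hτ)

theorem le_iff_forall_involution {b c : B} :
    b ≤ c ↔ ∀ τ, τ * τ = 1 → A.supp τ ≤ b → A.supp τ ≤ c := by
  refine ⟨fun h τ _ hb => hb.trans h, fun h => ?_⟩
  obtain ⟨F, hF, hs⟩ := A.exists_sup_supp b
  rw [← hs]
  exact Finset.sup_le fun τ hτ => h τ (hF τ hτ) (hs ▸ Finset.le_sup hτ)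

/-- This expresses complements through inclusions of supports of involutions, the only data that a
group isomorphism is known to preserve. -/
theorem supp_le_compl_iff {τ : G} {b : B} :
    A.supp τ ≤ bᶜ ↔
      ∀ σ, σ * σ = 1 → σ ≠ 1 → A.supp σ ≤ A.supp τ → ¬ A.supp σ ≤ b := by
  constructor
  · intro h σ _ h1 hle hb
    apply h1
    rw [← A.supp_eq_bot_iff, ← disjoint_self]
    exact (le_compl_iff_disjoint_right.1 h).mono hle hb
  · intro h
    rw [le_compl_iff_disjoint_right, disjoint_iff]
    by_contra hb
    obtain ⟨σ, h1, h2, h3⟩ := A.exists_involution hb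
    exact h σ h1 h2 (h3.trans inf_le_left) (h3.trans inf_le_right)

/-! ### Reconstruction of the Boolean algebra from the group -/

section Reconstruction

variable {G' B' : Type*} [Group G'] [BooleanAlgebra B'] (A' : SupportedAction G' B')
  (f : G ≃* G')

theorem supp_map_le_iff {τ φ : G} (hτ : τ * τ = 1) :
    A'.supp (f φ) ≤ A'.supp (f τ) ↔ A.supp φ ≤ A.supp τ := by
  rw [← A.mem_supportCentralizer_iff hτ, ← map_mem_supportCentralizer_iff f,
    A'.mem_supportCentralizer_iff (by rw [← map_mul, hτ, map_one])]

theorem exists_corresponding (b : B) :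
    ∃ b' : B', ∀ τ, τ * τ = 1 → (A.supp τ ≤ b ↔ A'.supp (f τ) ≤ b') := by
  have compl : ∀ (b : B) (b' : B'),
      (∀ τ, τ * τ = 1 → (A.supp τ ≤ b ↔ A'.supp (f τ) ≤ b')) →
      ∀ τ, τ * τ = 1 → (A.supp τ ≤ bᶜ ↔ A'.supp (f τ) ≤ b'ᶜ) := by
    intro b b' H τ hτ
    rw [supp_le_compl_iff, supp_le_compl_iff]
    constructor
    · intro h σ' hσ hσ1 hle hb
      obtain ⟨σ, rfl⟩ := f.surjective σ'
      have hσ2 : σ * σ = 1 := f.injective (by rw [map_mul, hσ, map_one])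
      exact h σ hσ2 (fun h => hσ1 (by rw [h, map_one])) ((supp_map_le_iff A A' f hτ).1 hle)
        ((H σ hσ2).2 hb)
    · intro h σ hσ hσ1 hle hb
      exact h (f σ) (by rw [← map_mul, hσ, map_one]) (by simpa using hσ1)
        ((supp_map_le_iff A A' f hτ).2 hle) ((H σ hσ).1 hb)
  obtain ⟨F, hF, rfl⟩ := A.exists_sup_supp b
  classical
  induction F using Finset.induction_on with
  | empty =>
    refine ⟨⊥, fun τ _ => ?_⟩
    rw [Finset.sup_empty, le_bot_iff, le_bot_iff, supp_eq_bot_iff, supp_eq_bot_iff]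
    simp
  | insert σ F _ ih =>
    obtain ⟨b', hb'⟩ := ih fun τ hτ => hF τ (Finset.mem_insert_of_mem hτ)
    have hσ : σ * σ = 1 := hF σ (Finset.mem_insert_self _ _)
    -- Lying below a meet splits into two conditions, lying below a join does not; so the join is
    -- written with complements, which are already known to correspond.
    refine ⟨((A'.supp (f σ))ᶜ ⊓ b'ᶜ)ᶜ, ?_⟩
    rw [Finset.sup_insert, show A.supp σ ⊔ F.sup A.supp =
      ((A.supp σ)ᶜ ⊓ (F.sup A.supp)ᶜ)ᶜ by simp]
    apply compl
    intro τ hτ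
    rw [le_inf_iff, le_inf_iff, compl _ _ hb' τ hτ,
      compl _ _ (fun φ _ => (supp_map_le_iff A A' f hσ).symm) τ hτ]

/-- An isomorphism of groups with supported actions is implemented by an isomorphism of the
Boolean algebras. -/
theorem exists_equivariant_orderIso :
    ∃ α : B ≃o B', ∀ g b, α (A.act g b) = A'.act (f g) (α b) := by
  choose α hα using exists_corresponding A A' f
  choose β hβ using exists_corresponding A' A f.symm
  have mono : ∀ {b c}, α b ≤ α c ↔ b ≤ c := by
    intro b c
    rw [A.le_iff_forall_involution, A'.le_iff_forall_involution]
    constructor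
    · intro h τ hτ hb
      exact (hα c τ hτ).2 (h (f τ) (by rw [← map_mul, hτ, map_one]) ((hα b τ hτ).1 hb))
    · intro h τ' hτ' hb
      obtain ⟨τ, rfl⟩ := f.surjective τ'
      have hτ : τ * τ = 1 := f.injective (by rw [map_mul, hτ', map_one])
      exact (hα c τ hτ).1 (h τ hτ ((hα b τ hτ).2 hb))
  -- An element is determined by the involutions supported below it. Surjectivity and equivariance
  -- of `α` both follow from this uniqueness.
  have uniq : ∀ b b', (∀ τ, τ * τ = 1 → (A.supp τ ≤ b ↔ A'.supp (f τ) ≤ b')) → α b = b' := by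
    intro b b' H
    have : ∀ τ', τ' * τ' = 1 → (A'.supp τ' ≤ α b ↔ A'.supp τ' ≤ b') := by
      intro τ' hτ'
      obtain ⟨τ, rfl⟩ := f.surjective τ'
      have hτ : τ * τ = 1 := f.injective (by rw [map_mul, hτ', map_one])
      rw [← hα b τ hτ, H τ hτ]
    exact le_antisymm (A'.le_iff_forall_involution.2 fun τ hτ => (this τ hτ).1)
      (A'.le_iff_forall_involution.2 fun τ hτ => (this τ hτ).2)
  have surj : Function.Surjective α := by
    intro b'
    refine ⟨β b', uniq _ _ fun τ hτ => ?_⟩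
    simpa using (hβ b' (f τ) (by rw [← map_mul, hτ, map_one])).symm
  refine ⟨RelIso.ofSurjective (OrderEmbedding.ofMapLEIff α fun _ _ => mono) surj, fun g b => ?_⟩
  refine uniq _ _ fun τ hτ => ?_
  have hτ' : (g⁻¹ * τ * g⁻¹⁻¹) * (g⁻¹ * τ * g⁻¹⁻¹) = 1 := by
    calc _ = g⁻¹ * (τ * τ) * g := by group
      _ = 1 := by rw [hτ]; group
  have := hα b _ hτ'
  rw [A.supp_conj, map_mul f, map_mul f, map_inv f g⁻¹, A'.supp_conj, map_inv f] at this
  have e1 : A.act g⁻¹ (A.supp τ) ≤ b ↔ A.supp τ ≤ A.act g b := by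
    rw [← (A.act g).le_iff_le, act_act_inv]
  have e2 : A'.act (f g)⁻¹ (A'.supp (f τ)) ≤ α b ↔ A'.supp (f τ) ≤ A'.act (f g) (α b) := by
    rw [← (A'.act (f g)).le_iff_le, act_act_inv]
  rw [← e1, this, e2]
  rfl

end Reconstruction

end SupportedAction

/-! ### Calculus of inverse monoids and conjugation of idempotents -/

namespace InverseMonoidWithZero

section Basic

variable {S : Type u} [InverseMonoidWithZero S]

@[simp] theorem inverse_inverse (a : S) : a⁻¹⁻¹ = a :=
  (inv_unique a⁻¹ a (inv_mul_inv a) (mul_inv_mul a)).symm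

theorem ran_idem (a : S) : (a * a⁻¹) * (a * a⁻¹) = a * a⁻¹ := by
  rw [← mul_assoc, mul_inv_mul]

@[simp] theorem mul_inverse_mul (a : S) : a * (a⁻¹ * a) = a := by
  rw [← mul_assoc, mul_inv_mul]

@[simp] theorem inverse_mul_inverse (a : S) : a⁻¹ * (a * a⁻¹) = a⁻¹ := by
  rw [← mul_assoc, inv_mul_inv]

@[simp] theorem inverse_mul (a b : S) : (a * b)⁻¹ = b⁻¹ * a⁻¹ := by
  symm
  have h := idem_comm (ran_idem b) (dom_idem a)
  apply inv_unique
  · calc a * b * (b⁻¹ * a⁻¹) * (a * b) = a * ((b * b⁻¹) * (a⁻¹ * a)) * b := by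
          simp only [mul_assoc]
      _ = (a * a⁻¹ * a) * (b * b⁻¹ * b) := by rw [h]; simp only [mul_assoc]
      _ = a * b := by rw [mul_inv_mul, mul_inv_mul]
  · calc b⁻¹ * a⁻¹ * (a * b) * (b⁻¹ * a⁻¹) = b⁻¹ * ((a⁻¹ * a) * (b * b⁻¹)) * a⁻¹ := by
          simp only [mul_assoc]
      _ = (b⁻¹ * b * b⁻¹) * (a⁻¹ * a * a⁻¹) := by rw [← h]; simp only [mul_assoc]
      _ = b⁻¹ * a⁻¹ := by rw [inv_mul_inv, inv_mul_inv]

theorem inverse_of_idem {e : S} (he : e * e = e) : e⁻¹ = e :=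
  (inv_unique e e (by rw [he, he]) (by rw [he, he])).symm

@[simp] theorem inverse_one : (1 : S)⁻¹ = 1 := inverse_of_idem (one_mul 1)

@[simp] theorem inverse_zero : (0 : S)⁻¹ = 0 := inverse_of_idem (zero_mul 0)

theorem coe_units_inv (g : Sˣ) : ((g⁻¹ : Sˣ) : S) = (g : S)⁻¹ :=
  inv_unique _ _ (by simp) (by simp)

theorem le_iff_eq_mul_dom {a b : S} : a ≤ b ↔ a = b * (a⁻¹ * a) := by
  rw [← mul_assoc]; rfl

theorem mul_idem_le (b : S) {e : S} (he : e * e = e) : b * e ≤ b := by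
  rw [le_iff_eq_mul_dom, inverse_mul, inverse_of_idem he]
  calc b * e = b * (b⁻¹ * b) * (e * e) := by rw [mul_inverse_mul, he]
    _ = b * ((b⁻¹ * b) * e) * e := by simp only [mul_assoc]
    _ = b * (e * b⁻¹ * (b * e)) := by
      rw [idem_comm (dom_idem b) he]; simp only [mul_assoc]

theorem idem_mul_eq (b : S) {e : S} (he : e * e = e) : e * b = b * (b⁻¹ * e * b) := by
  calc e * b = e * (b * b⁻¹) * b := by rw [mul_assoc, mul_assoc, mul_inverse_mul]
    _ = b * (b⁻¹ * e * b) := by rw [idem_comm he (ran_idem b)]; simp only [mul_assoc]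

theorem mul_idem_eq (b : S) {e : S} (he : e * e = e) : b * e = (b * e * b⁻¹) * b := by
  calc b * e = b * ((b⁻¹ * b) * e) := by rw [← mul_assoc, mul_inverse_mul]
    _ = (b * e * b⁻¹) * b := by rw [idem_comm (dom_idem b) he]; simp only [mul_assoc]

theorem conj_idem (s : S) {e : S} (he : e * e = e) :
    (s * e * s⁻¹) * (s * e * s⁻¹) = s * e * s⁻¹ := by
  calc (s * e * s⁻¹) * (s * e * s⁻¹) = s * (e * (s⁻¹ * s)) * e * s⁻¹ := by
        simp only [mul_assoc]
    _ = (s * (s⁻¹ * s)) * (e * e) * s⁻¹ := by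
        rw [idem_comm he (dom_idem s)]; simp only [mul_assoc]
    _ = s * e * s⁻¹ := by rw [mul_inverse_mul, he]

theorem inv_conj_idem (s : S) {e : S} (he : e * e = e) :
    (s⁻¹ * e * s) * (s⁻¹ * e * s) = s⁻¹ * e * s := by
  simpa using conj_idem s⁻¹ he

theorem idem_mul_le_self (b : S) {e : S} (he : e * e = e) : e * b ≤ b := by
  rw [idem_mul_eq b he]
  exact mul_idem_le b (inv_conj_idem b he)

theorem mul_le_mul_idem {a b c d : S} (hab : a ≤ b) (hcd : c ≤ d) : a * c ≤ b * d := by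
  rw [le_iff_eq_mul_dom] at hab hcd
  rw [hab, hcd]
  have := idem_mul_eq (d * (c⁻¹ * c)) (dom_idem a)
  calc b * (a⁻¹ * a) * (d * (c⁻¹ * c)) = b * ((a⁻¹ * a) * (d * (c⁻¹ * c))) := mul_assoc _ _ _
    _ = b * d * ((c⁻¹ * c) * ((d * (c⁻¹ * c))⁻¹ * (a⁻¹ * a) * (d * (c⁻¹ * c)))) := by
      rw [this]; simp only [mul_assoc]
    _ ≤ b * d := mul_idem_le _ (idem_mul (dom_idem c) (inv_conj_idem _ (dom_idem a)))

theorem inverse_le_inverse {a b : S} (h : a ≤ b) : a⁻¹ ≤ b⁻¹ := by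
  rw [le_iff_eq_mul_dom] at h
  rw [h, inverse_mul, inverse_of_idem (dom_idem a)]
  exact idem_mul_le_self _ (dom_idem a)

theorem inverse_le_inverse_iff {a b : S} : a⁻¹ ≤ b⁻¹ ↔ a ≤ b :=
  ⟨fun h => by simpa using inverse_le_inverse h, inverse_le_inverse⟩

theorem le_one_iff {a : S} : a ≤ 1 ↔ a * a = a := by
  constructor
  · intro h
    rw [le_iff_eq_mul_dom, one_mul] at h
    rw [h, dom_idem]
  · intro h
    simpa using mul_idem_le 1 h

theorem idem_le_iff {e f : S} (he : e * e = e) : e ≤ f ↔ f * e = e := by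
  rw [le_iff_eq_mul_dom, inverse_of_idem he, he, eq_comm]

theorem zero_le' (a : S) : 0 ≤ a := by
  rw [idem_le_iff (zero_mul 0), mul_zero]

theorem isLUB_inverse {X : Set S} {c : S} (h : IsLUB X c) :
    IsLUB ((fun a => a⁻¹) '' X) c⁻¹ := by
  constructor
  · rintro _ ⟨a, ha, rfl⟩
    exact inverse_le_inverse (h.1 ha)
  · intro d hd
    rw [← inverse_le_inverse_iff, inverse_inverse]
    refine h.2 fun a ha => ?_
    rw [← inverse_le_inverse_iff, inverse_inverse]
    exact hd ⟨a, ha, rfl⟩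

variable (S) in
/-- The semilattice of idempotents. -/
abbrev Idem := {e : S // IsIdempotentElem e}

/-- The domain idempotent. -/
def dom (s : S) : Idem S := ⟨s⁻¹ * s, dom_idem s⟩

/-- The range idempotent. -/
def ran (s : S) : Idem S := ⟨s * s⁻¹, ran_idem s⟩

/-- The action of an element on the idempotents. -/
def conj (s : S) (e : Idem S) : Idem S := ⟨s * e * s⁻¹, conj_idem s e.2⟩

@[simp] theorem coe_dom (s : S) : (dom s : S) = s⁻¹ * s := rfl
@[simp] theorem coe_ran (s : S) : (ran s : S) = s * s⁻¹ := rfl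
@[simp] theorem coe_conj (s : S) (e : Idem S) : (conj s e : S) = s * e * s⁻¹ := rfl

@[simp] theorem dom_inverse (s : S) : dom s⁻¹ = ran s := Subtype.ext (by simp)
@[simp] theorem ran_inverse (s : S) : ran s⁻¹ = dom s := Subtype.ext (by simp)

theorem conj_mul (s t : S) (e : Idem S) : conj (s * t) e = conj s (conj t e) :=
  Subtype.ext (by simp [mul_assoc])

@[simp] theorem conj_one (e : Idem S) : conj 1 e = e := Subtype.ext (by simp)

@[simp] theorem idem_mul_self (e : Idem S) : (e : S) * e = e := e.2

@[simp] theorem idem_inverse (e : Idem S) : (e : S)⁻¹ = e := inverse_of_idem e.2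

theorem mul_dom (s : S) : s * (dom s : S) = s := mul_inverse_mul s

theorem ran_mul (s : S) : (ran s : S) * s = s := mul_inv_mul s

theorem mul_coe (s : S) (e : Idem S) : s * (e : S) = (conj s e : S) * s := mul_idem_eq s e.2

theorem coe_comm (e f : Idem S) : (e : S) * f = f * e := idem_comm e.2 f.2

theorem conj_mono (s : S) : Monotone (conj s) := fun _ _ h =>
  mul_le_mul_idem (mul_le_mul_idem le_rfl h) le_rfl

theorem idem_le_iff' {e f : Idem S} : e ≤ f ↔ (f : S) * e = e := idem_le_iff e.2

theorem dom_mono {a b : S} (h : a ≤ b) : dom a ≤ dom b :=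
  mul_le_mul_idem (inverse_le_inverse h) h

theorem coe_le_one (e : Idem S) : (e : S) ≤ 1 := le_one_iff.2 e.2

theorem dom_mul_le (s t : S) : dom (s * t) ≤ dom t := by
  have : (dom (s * t) : S) = t⁻¹ * (dom s : S) * t := by simp [mul_assoc]
  change (dom (s * t) : S) ≤ (dom t : S)
  rw [this]
  exact mul_le_mul_idem (by simpa using mul_idem_le t⁻¹ (dom s).2) le_rfl

theorem ran_mul_le (s t : S) : ran (s * t) ≤ ran s := by
  rw [← dom_inverse, ← dom_inverse s, inverse_mul]
  exact dom_mul_le _ _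

theorem dom_mul (s t : S) : dom (s * t) = conj t⁻¹ (dom s) :=
  Subtype.ext (by simp [mul_assoc])

theorem ran_mul_eq (s t : S) : ran (s * t) = conj s (ran t) :=
  Subtype.ext (by simp [mul_assoc])

@[simp] theorem dom_coe (e : Idem S) : dom (e : S) = e := Subtype.ext (by simp)
@[simp] theorem ran_coe (e : Idem S) : ran (e : S) = e := Subtype.ext (by simp)

theorem mul_coe_eq_of_dom_le {s : S} {e : Idem S} (h : dom s ≤ e) : s * (e : S) = s := by
  rw [idem_le_iff'] at h
  rw [← mul_dom s, mul_assoc, coe_comm, h]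

/-- In a fundamental inverse monoid, elements are determined by their action on idempotents. -/
theorem eq_of_conj_eq (hS : IsFundamental S) {s t : S} (h : ∀ e, conj s e = conj t e) :
    s = t := by
  have key : ∀ {s t : S}, (∀ e, conj s e = conj t e) → t ≤ s := by
    intro s t h
    have h' : ∀ e : S, e * e = e → s * e * s⁻¹ = t * e * t⁻¹ := fun e he =>
      congrArg Subtype.val (h ⟨e, he⟩)
    have hr : s * s⁻¹ = t * t⁻¹ := by simpa using h' 1 (one_mul 1)
    have hi : IsIdempotentElem (s⁻¹ * t) := by
      apply hS
      -- Conjugation by `s⁻¹ * t` acts on idempotents as multiplication by `s⁻¹ * s`, so `s⁻¹ * t`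
      -- commutes with every idempotent.
      intro e he
      have he : e * e = e := he
      have h1 := mul_idem_eq (s⁻¹ * t) he
      have h2 : (s⁻¹ * t) * e * (s⁻¹ * t)⁻¹ = e * (s⁻¹ * s) := by
        calc (s⁻¹ * t) * e * (s⁻¹ * t)⁻¹ = s⁻¹ * (t * e * t⁻¹) * s := by simp [mul_assoc]
          _ = (s⁻¹ * s) * e * (s⁻¹ * s) := by rw [← h' e he]; simp only [mul_assoc]
          _ = e * (s⁻¹ * s) := by
            rw [idem_comm (dom_idem s) he, mul_assoc, dom_idem]
      rw [h1, h2]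
      calc e * (s⁻¹ * s) * (s⁻¹ * t) = e * (s⁻¹ * s * s⁻¹) * t := by simp only [mul_assoc]
        _ = e * (s⁻¹ * t) := by rw [inv_mul_inv, mul_assoc]
    have : t = s * (s⁻¹ * t) := by rw [← mul_assoc, hr, mul_inv_mul]
    rw [this]
    exact mul_idem_le s hi
  exact le_antisymm (key fun e => (h e).symm) (key h)

theorem compatible_coe (e f : Idem S) : Compatible (e : S) f :=
  ⟨by rw [idem_inverse]; exact idem_mul e.2 f.2, by rw [idem_inverse]; exact idem_mul e.2 f.2⟩

theorem ran_mul_coe (s : S) (e : Idem S) : ran (s * e) = conj s e := by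
  rw [ran_mul_eq, ran_coe]

theorem mul_dom_of_le {a c : S} (h : a ≤ c) : c * (dom a : S) = a :=
  (le_iff_eq_mul_dom.1 h).symm

end Basic

/-! ### The Boolean algebra of idempotents -/

section Boolean

variable {S : Type u} [InverseMonoidWithZero S] [IsBooleanInverseMonoid S]

/-- Joins and complements are transported from the abstract algebra, while the meet, top and bottom
are taken to be the product, `1` and `0`, so that their coercions to `S` are definitional. -/
noncomputable instance : BooleanAlgebra (Idem S) :=
  let B := Classical.choose (IsBooleanInverseMonoid.idempotents_boolean (S := S))
  letI : BooleanAlgebra B :=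
    Classical.choose (Classical.choose_spec
      (IsBooleanInverseMonoid.idempotents_boolean (S := S)))
  let i : B ≃o Idem S := Classical.choice (Classical.choose_spec (Classical.choose_spec
      (IsBooleanInverseMonoid.idempotents_boolean (S := S))))
  have hbot : i ⊥ = ⟨0, zero_mul 0⟩ := by
    apply le_antisymm
    · rw [← i.le_symm_apply]; exact bot_le
    · exact zero_le' _
  have htop : i ⊤ = ⟨1, one_mul 1⟩ := by
    apply le_antisymm
    · exact le_one_iff.2 (i ⊤).2
    · rw [← i.symm_apply_le]; exact le_top
  have hinf : ∀ a b : Idem S, i (i.symm a ⊓ i.symm b) = ⟨a * b, idem_mul a.2 b.2⟩ := by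
    intro a b
    apply le_antisymm
    · have h1 : i (i.symm a ⊓ i.symm b) ≤ a := by
        rw [← i.le_symm_apply]; exact inf_le_left
      have h2 : i (i.symm a ⊓ i.symm b) ≤ b := by
        rw [← i.le_symm_apply]; exact inf_le_right
      rw [idem_le_iff'] at h1 h2 ⊢
      change (a : S) * b * _ = _
      rw [mul_assoc, h2, h1]
    · rw [← i.symm_apply_le]
      refine le_inf (i.symm.monotone ?_) (i.symm.monotone ?_)
      · exact mul_idem_le _ b.2
      · exact idem_mul_le_self _ a.2
  { (inferInstance : PartialOrder (Idem S)) with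
    sup := fun a b => i (i.symm a ⊔ i.symm b)
    le_sup_left := fun a b => by
      change a ≤ i _; rw [← i.symm_apply_le]; exact le_sup_left
    le_sup_right := fun a b => by
      change b ≤ i _; rw [← i.symm_apply_le]; exact le_sup_right
    sup_le := fun a b c ha hb => by
      change i _ ≤ c
      rw [← i.le_symm_apply]
      exact sup_le (i.symm.monotone ha) (i.symm.monotone hb)
    inf := fun a b => ⟨a * b, idem_mul a.2 b.2⟩
    inf_le_left := fun a b => mul_idem_le _ b.2
    inf_le_right := fun a b => idem_mul_le_self _ a.2
    le_inf := fun a b c hb hc => by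
      rw [← hinf, ← i.symm_apply_le]
      exact le_inf (i.symm.monotone hb) (i.symm.monotone hc)
    le_sup_inf := fun a b c => by
      refine (hinf _ _).symm.le.trans (le_trans ?_
        (congrArg (fun x => i (i.symm a ⊔ i.symm x)) (hinf b c)).le)
      simp only [OrderIso.symm_apply_apply, i.le_iff_le]
      refine le_trans (le_of_eq ?_) le_sup_inf
      exact congrArg₂ (· ⊓ ·) (i.symm_apply_apply _) (i.symm_apply_apply _)
    top := ⟨1, one_mul 1⟩
    bot := ⟨0, zero_mul 0⟩
    le_top := fun a => le_one_iff.2 a.2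
    bot_le := fun a => zero_le' _
    compl := fun a => i (i.symm a)ᶜ
    inf_compl_le_bot := fun a => by
      refine (hinf _ _).symm.le.trans (le_trans ?_ hbot.le)
      simp
    top_le_sup_compl := fun a => by
      rw [← htop]
      change _ ≤ i _
      simp }

@[simp] theorem coe_inf (e f : Idem S) : ((e ⊓ f : Idem S) : S) = e * f := rfl
@[simp] theorem coe_bot : ((⊥ : Idem S) : S) = 0 := rfl
@[simp] theorem coe_top : ((⊤ : Idem S) : S) = 1 := rfl

theorem disjoint_iff_mul_eq_zero {e f : Idem S} : Disjoint e f ↔ (e : S) * f = 0 := by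
  rw [disjoint_iff, Subtype.ext_iff]; rfl

/-- A join in `S` of two idempotents lies below `1`, hence is idempotent; so joins in `Idem S` and
in `S` agree. -/
theorem isLUB_coe_sup (e f : Idem S) : IsLUB {(e : S), (f : S)} ((e ⊔ f : Idem S) : S) := by
  have hc : Compatible (e : S) f :=
    ⟨by rw [idem_inverse]; exact idem_mul e.2 f.2, by rw [idem_inverse]; exact idem_mul e.2 f.2⟩
  obtain ⟨c, hc⟩ := IsBooleanInverseMonoid.exists_join (e : S) f hc
  have hc1 : c ≤ 1 := hc.2 (by
    rintro _ (rfl | rfl)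
    · exact coe_le_one e
    · exact coe_le_one f)
  let c' : Idem S := ⟨c, le_one_iff.1 hc1⟩
  have : e ⊔ f = c' := by
    apply le_antisymm
    · exact sup_le (hc.1 (by simp)) (hc.1 (by simp))
    · exact hc.2 (by
        rintro _ (rfl | rfl)
        · exact (le_sup_left : e ≤ e ⊔ f)
        · exact (le_sup_right : f ≤ e ⊔ f))
  rw [this]
  exact hc

theorem isLUB_mul_sup (a : S) (e f : Idem S) :
    IsLUB {a * (e : S), a * (f : S)} (a * ((e ⊔ f : Idem S) : S)) :=
  IsBooleanInverseMonoid.mul_join a _ _ _ (compatible_coe e f) (isLUB_coe_sup e f)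

theorem eq_on_sup {a b : S} {e f : Idem S} (he : a * (e : S) = b * e) (hf : a * (f : S) = b * f) :
    a * ((e ⊔ f : Idem S) : S) = b * ((e ⊔ f : Idem S) : S) :=
  (isLUB_mul_sup a e f).unique (he ▸ hf ▸ isLUB_mul_sup b e f)

theorem conj_inverse_conj (s : S) (e : Idem S) : conj s⁻¹ (conj s e) = dom s ⊓ e := by
  apply Subtype.ext
  rw [coe_conj, coe_conj, coe_inf, inverse_inverse, coe_dom]
  calc s⁻¹ * (s * e * s⁻¹) * s = (s⁻¹ * s) * (e * (s⁻¹ * s)) := by simp only [mul_assoc]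
    _ = s⁻¹ * s * e := by rw [idem_comm e.2 (dom_idem s), ← mul_assoc, dom_idem]

theorem conj_conj_inverse (s : S) (e : Idem S) : conj s (conj s⁻¹ e) = ran s ⊓ e := by
  simpa using conj_inverse_conj s⁻¹ e

theorem conj_dom_inf (s : S) (e : Idem S) : conj s (dom s ⊓ e) = conj s e := by
  apply Subtype.ext
  rw [coe_conj, coe_conj, coe_inf, ← mul_assoc, mul_dom]

/-- As a left adjoint, `conj s` preserves finite joins. -/
theorem conj_gc (s : S) : GaloisConnection (conj s) fun f => dom s ⇨ conj s⁻¹ f := by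
  intro e f
  rw [le_himp_iff, inf_comm]
  constructor
  · intro h
    rw [← conj_inverse_conj]
    exact conj_mono _ h
  · intro h
    rw [← conj_dom_inf]
    refine (conj_mono s h).trans ?_
    rw [conj_conj_inverse]
    exact inf_le_right

theorem conj_sup (s : S) (e f : Idem S) : conj s (e ⊔ f) = conj s e ⊔ conj s f :=
  (conj_gc s).l_sup

@[simp] theorem conj_bot (s : S) : conj s ⊥ = ⊥ := (conj_gc s).l_bot

theorem conj_le_ran (s : S) (e : Idem S) : conj s e ≤ ran s := by
  have : conj s ⊤ = ran s := Subtype.ext (by simp)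
  rw [← this]
  exact conj_mono s le_top

theorem conj_eq_bot_iff {s : S} {e : Idem S} : conj s e = ⊥ ↔ Disjoint (dom s) e := by
  rw [disjoint_iff, ← conj_inverse_conj]
  constructor
  · intro h; rw [h, conj_bot]
  · intro h
    rw [← conj_dom_inf, ← conj_inverse_conj, h, conj_bot]

theorem dom_eq_bot_iff {s : S} : dom s = ⊥ ↔ s = 0 := by
  constructor
  · intro h
    rw [← mul_dom s, h, coe_bot, mul_zero]
  · rintro rfl
    exact Subtype.ext (by simp)

theorem ran_eq_bot_iff {s : S} : ran s = ⊥ ↔ s = 0 := by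
  constructor
  · intro h
    rw [← ran_mul s, h, coe_bot, zero_mul]
  · rintro rfl
    exact Subtype.ext (by simp)

theorem dom_mul_coe (s : S) (e : Idem S) : dom (s * e) = dom s ⊓ e := by
  rw [dom_mul, idem_inverse]
  apply Subtype.ext
  rw [coe_conj, idem_inverse, coe_inf, coe_comm, mul_assoc, idem_mul_self]

theorem mul_eq_zero_iff {s t : S} : s * t = 0 ↔ Disjoint (dom s) (ran t) := by
  rw [← conj_eq_bot_iff, ← ran_mul_eq, ran_eq_bot_iff]

/-- Cutting `c` down to `dom a ⊔ dom b` still leaves an upper bound of `a` and `b`. -/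
theorem dom_sup_of_isLUB {a b c : S} (h : IsLUB {a, b} c) : dom c = dom a ⊔ dom b := by
  have hac : a ≤ c := h.1 (by simp)
  have hbc : b ≤ c := h.1 (by simp)
  apply le_antisymm
  · have hle : c ≤ c * ((dom a ⊔ dom b : Idem S) : S) := by
      apply h.2
      have key : ∀ d, d ≤ c → dom d ≤ dom a ⊔ dom b →
          d ≤ c * ((dom a ⊔ dom b : Idem S) : S) := by
        intro d hd hdd
        rw [← mul_coe_eq_of_dom_le hdd]
        exact mul_le_mul_idem hd le_rfl
      rintro _ (rfl | rfl)
      · exact key _ hac le_sup_left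
      · exact key _ hbc le_sup_right
    refine (dom_mono hle).trans ?_
    rw [dom_mul_coe]
    exact inf_le_right
  · exact sup_le (dom_mono hac) (dom_mono hbc)

theorem isComplement_compl (e : Idem S) : IsComplement (e : S) ((eᶜ : Idem S) : S) := by
  refine ⟨(eᶜ).2, ?_, ?_⟩
  · rw [← disjoint_iff_mul_eq_zero]; exact disjoint_compl_right
  · simpa using isLUB_coe_sup e eᶜ

end Boolean

end InverseMonoidWithZero

theorem Order.Ideal.exists_isPrime_of_notMem {B : Type*} [BooleanAlgebra B] {J : Order.Ideal B}
    {b : B} (hb : b ∉ J) : ∃ P : Order.Ideal B, P.IsPrime ∧ J ≤ P ∧ b ∉ P := by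
  have hd : Disjoint (Order.PFilter.principal b : Set B) (J : Set B) := by
    rw [Set.disjoint_left]
    intro x hx hxJ
    exact hb (J.lower hx hxJ)
  obtain ⟨P, h1, h2, h3⟩ := DistribLattice.prime_ideal_of_disjoint_filter_ideal hd
  exact ⟨P, h1, h2, Set.disjoint_left.1 h3 (le_refl b)⟩

/-! ### Special involutions and minimality -/

namespace InverseMonoidWithZero

section Boolean

variable {S : Type u} [InverseMonoidWithZero S]

theorem conj_congr {s t : S} {e : Idem S} (h : s * (e : S) = t * e) : conj s e = conj t e := by
  rw [← ran_mul_coe, ← ran_mul_coe, h]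

theorem mul_coe_congr {s t : S} {e f : Idem S} (h : s * (e : S) = t * e) (hf : f ≤ e) :
    s * (f : S) = t * f := by
  rw [idem_le_iff'] at hf
  rw [← hf, ← mul_assoc, h, mul_assoc]

theorem conj_dom (a : S) : conj a (dom a) = ran a := by
  rw [← ran_mul_coe, mul_dom]

theorem conj_units_inv_conj (g : Sˣ) (e : Idem S) :
    conj ((g⁻¹ : Sˣ) : S) (conj (g : S) e) = e := by
  rw [← conj_mul]; simp

theorem conj_units_conj_inv (g : Sˣ) (e : Idem S) :
    conj (g : S) (conj ((g⁻¹ : Sˣ) : S) e) = e := by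
  rw [← conj_mul]; simp

/-- The action of units on idempotents by conjugation. -/
def unitsConj : Sˣ →* (Idem S ≃o Idem S) where
  toFun g :=
    { toFun := conj (g : S)
      invFun := conj ((g⁻¹ : Sˣ) : S)
      left_inv := conj_units_inv_conj g
      right_inv := conj_units_conj_inv g
      map_rel_iff' := by
        intro a b
        refine ⟨fun h => ?_, fun h => conj_mono _ h⟩
        have := conj_mono ((g⁻¹ : Sˣ) : S) h
        rw [Equiv.coe_fn_mk, conj_units_inv_conj, conj_units_inv_conj] at this
        exact this }
  map_one' := by ext1; funext e; exact conj_one e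
  map_mul' g h := by ext1; funext e; exact conj_mul _ _ e

variable [IsBooleanInverseMonoid S]

theorem dom_units (g : Sˣ) : dom (g : S) = ⊤ :=
  Subtype.ext (by simp [← coe_units_inv])

/-- The special involution exchanging the domain and the range of an element of square zero. -/
theorem exists_specialInvolution {a : S} (ha0 : a ≠ 0) (ha : a * a = 0) :
    ∃ g : Sˣ, IsSpecialInvolution g ∧ g * g = 1 ∧ (g : S) * (dom a : S) = a ∧
      (g : S) * (ran a : S) = a⁻¹ ∧
      (g : S) * (((dom a ⊔ ran a)ᶜ : Idem S) : S) = (((dom a ⊔ ran a)ᶜ : Idem S) : S) := by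
  have hi : IsIdempotentElem (0 : S) := zero_mul 0
  -- Square zero makes `a⁻¹` and `a` compatible. Their join is its own inverse, and joining the
  -- complement of its domain gives a self-inverse element with full domain, that is, a unit.
  obtain ⟨c, hc⟩ := IsBooleanInverseMonoid.exists_join a⁻¹ a
    ⟨by rwa [inverse_inverse, ha], by rwa [← inverse_mul, ha, inverse_zero]⟩
  have hci : c⁻¹ = c := by
    have := isLUB_inverse hc
    rw [Set.image_pair, inverse_inverse, Set.pair_comm] at this
    exact this.unique hc
  have hdc : dom c = dom a ⊔ ran a := by
    rw [dom_sup_of_isLUB hc, dom_inverse, sup_comm]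
  have hcf : c * (((dom a ⊔ ran a)ᶜ : Idem S) : S) = 0 := by
    rw [mul_eq_zero_iff, hdc, ran_coe]; exact disjoint_compl_right
  obtain ⟨g, hg⟩ := IsBooleanInverseMonoid.exists_join c (((dom a ⊔ ran a)ᶜ : Idem S) : S)
    ⟨by rwa [hci, hcf], by rwa [idem_inverse, hcf]⟩
  have hgi : g⁻¹ = g := by
    have := isLUB_inverse hg
    rw [Set.image_pair, hci, idem_inverse] at this
    exact this.unique hg
  have hdg : dom g = ⊤ := by
    rw [dom_sup_of_isLUB hg, hdc, dom_coe, sup_compl_eq_top]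
  have hgg : g * g = 1 := by
    have := congrArg Subtype.val hdg
    rwa [coe_dom, hgi, coe_top] at this
  have hcg : c ≤ g := hg.1 (by simp)
  have hac : a ≤ c := hc.1 (by simp)
  have hac' : a⁻¹ ≤ c := hc.1 (by simp)
  have hfg : (((dom a ⊔ ran a)ᶜ : Idem S) : S) ≤ g := hg.1 (by simp)
  refine ⟨⟨g, g, hgg, hgg⟩, ⟨a, _, _, ha0, by rw [pow_two, ha], isLUB_coe_sup (dom a) (ran a),
    isComplement_compl _, ?_⟩, Units.ext hgg, mul_dom_of_le (hac.trans hcg), ?_, ?_⟩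
  · constructor
    · rintro _ (rfl | rfl | rfl)
      · exact hac'.trans hcg
      · exact hac.trans hcg
      · exact hfg
    · intro d hd
      refine hg.2 ?_
      rintro _ (rfl | rfl)
      · refine hc.2 ?_
        rintro _ (rfl | rfl)
        · exact hd (by simp)
        · exact hd (by simp)
      · exact hd (by simp)
  · have := mul_dom_of_le (hac'.trans hcg)
    rwa [dom_inverse] at this
  · have := mul_dom_of_le hfg
    rwa [dom_coe] at this

/-- If no such `t` exists, the elements `s` all of whose right multiples have domain in `P` form a
join-closed two-sided ideal containing `f` but not `1`. -/
theorem exists_dom_notMem (hS : IsZeroSimplifying S) {P : Order.Ideal (Idem S)} (hP : ⊤ ∉ P)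
    {f : Idem S} (hf : f ≠ ⊥) : ∃ t : S, dom t ∉ P ∧ ran t ≤ f := by
  by_contra! H
  have hI := hS {s : S | ∀ u, dom (s * u) ∈ P}
    ⟨0, fun u => by rw [zero_mul, dom_eq_bot_iff.2 rfl]; exact P.bot_mem⟩ ?_ ?_
  · rcases hI with hI | hI
    · have hfI : (f : S) ∈ {s : S | ∀ u, dom (s * u) ∈ P} := by
        intro u
        by_contra hu
        exact H _ hu ((ran_mul_le _ _).trans (ran_coe f).le)
      rw [hI] at hfI
      exact hf (Subtype.ext hfI)
    · have h1 : (1 : S) ∈ {s : S | ∀ u, dom (s * u) ∈ P} := by rw [hI]; trivial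
      have h2 := h1 1
      rw [mul_one, show (1 : S) = ((⊤ : Idem S) : S) from rfl, dom_coe] at h2
      exact hP h2
  · intro s x hx
    refine ⟨fun u => ?_, fun u => ?_⟩
    · rw [mul_assoc]
      exact P.lower (dom_mul_le _ _) (hx u)
    · rw [mul_assoc]
      exact hx _
  · apply Set.Subset.antisymm
    · rintro c ⟨F, hfin, hFI, -, hc⟩ u
      have h1 : dom c ≤ hfin.toFinset.sup dom := by
        have hle : c ≤ c * ((hfin.toFinset.sup dom : Idem S) : S) := by
          apply hc.2
          intro d hd
          rw [← mul_coe_eq_of_dom_le (Finset.le_sup (f := dom) (hfin.mem_toFinset.2 hd))]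
          exact mul_le_mul_idem (hc.1 hd) le_rfl
        refine (dom_mono hle).trans ?_
        rw [dom_mul_coe]
        exact inf_le_right
      refine P.lower (dom_mul c u ▸ conj_mono _ h1) ?_
      rw [Finset.apply_sup_eq_sup_comp _ (conj_sup _) (conj_bot _)]
      refine (Order.Ideal.finsetSup_mem_iff P).2 ?_
      intro d hd
      rw [Function.comp_apply, ← dom_mul]
      exact hFI (hfin.mem_toFinset.1 hd) u
    · intro c hc
      exact ⟨{c}, Set.finite_singleton c, by simpa using hc, Set.pairwise_singleton _ _,
        isLUB_singleton⟩

end Boolean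

/-! ### Supports and involutions in simple Tarski monoids -/

section Simple

variable {S : Type u} [InverseMonoidWithZero S] [IsSimpleTarskiMonoid S]

theorem infinite_idem : Infinite (Idem S) := by
  by_contra h
  rw [not_infinite_iff_finite] at h
  have : Function.Injective (fun s : S => conj s) := fun s t hst =>
    eq_of_conj_eq IsSimpleTarskiMonoid.fundamental fun e => congrFun hst e
  exact (not_finite_iff_infinite.2 (IsTarskiMonoid.infinite (S := S))) (Finite.of_injective _ this)

/-- The idempotents with finitely many elements below them form a proper ideal. Some `t` has domain
outside it and range below `f`, and conjugation by `t` embeds the idempotents below `dom t` into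
those below `f`. -/
theorem infinite_Iic {f : Idem S} (hf : f ≠ ⊥) : (Set.Iic f).Infinite := by
  let P : Order.Ideal (Idem S) :=
    { carrier := {e | (Set.Iic e).Finite}
      lower' := fun a b hba ha => ha.subset (Set.Iic_subset_Iic.2 hba)
      nonempty' := ⟨⊥, by simp⟩
      directed' := by
        intro a ha b hb
        refine ⟨a ⊔ b, ?_, le_sup_left, le_sup_right⟩
        refine Set.Finite.subset (Set.Finite.image2 (· ⊔ ·) ha hb) ?_
        intro c hc
        refine ⟨c ⊓ a, Set.mem_Iic.2 inf_le_right, c ⊓ b, Set.mem_Iic.2 inf_le_right, ?_⟩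
        change c ⊓ a ⊔ c ⊓ b = c
        rw [← inf_sup_left, inf_eq_left]
        exact hc }
  have hP : ⊤ ∉ P := by
    intro h
    have h' : (Set.Iic (⊤ : Idem S)).Finite := h
    rw [Set.Iic_top] at h'
    exact (Set.infinite_univ_iff.2 infinite_idem) h'
  obtain ⟨t, ht, htf⟩ := exists_dom_notMem IsSimpleTarskiMonoid.zero_simplifying hP hf
  intro hfin
  apply ht
  change (Set.Iic (dom t)).Finite
  refine Set.Finite.subset (hfin.image (conj t⁻¹)) ?_
  intro e he
  refine ⟨conj t e, (conj_le_ran t e).trans htf, ?_⟩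
  rw [conj_inverse_conj, inf_eq_right]
  exact he

theorem exists_split {b : Idem S} (hb : b ≠ ⊥) :
    ∃ b₁ b₂ : Idem S, b₁ ≠ ⊥ ∧ b₂ ≠ ⊥ ∧ Disjoint b₁ b₂ ∧ b₁ ⊔ b₂ = b := by
  obtain ⟨c, hcb, hc⟩ := (infinite_Iic hb).exists_notMem_finite (Set.toFinite {⊥, b})
  simp only [Set.mem_insert_iff, Set.mem_singleton_iff, not_or] at hc
  refine ⟨c, b \ c, hc.1, ?_, disjoint_sdiff_self_right, sup_sdiff_cancel_right hcb⟩
  intro h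
  exact hc.2 (le_antisymm hcb (sdiff_eq_bot_iff.1 h))

/-- Split `b` into two disjoint nonzero parts, one of which is not in `P`. An element carrying a
piece of that part, still outside `P`, into the other part has disjoint domain and range. -/
theorem exists_sq_zero_of_isPrime {P : Order.Ideal (Idem S)} (hP : P.IsPrime) {b : Idem S}
    (hb : b ∉ P) : ∃ a : S, a * a = 0 ∧ dom a ∉ P ∧ dom a ≤ b ∧ ran a ≤ b := by
  have hb0 : b ≠ ⊥ := fun h => hb (h ▸ P.bot_mem)
  obtain ⟨b₁, b₂, h₁, h₂, hd, rfl⟩ := exists_split hb0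
  have key : ∀ {c d : Idem S}, c ∉ P → d ≠ ⊥ → Disjoint c d →
      ∃ a : S, a * a = 0 ∧ dom a ∉ P ∧ dom a ≤ c ⊔ d ∧ ran a ≤ c ⊔ d := by
    intro c d hc hd hcd
    obtain ⟨t, ht, htd⟩ := exists_dom_notMem IsSimpleTarskiMonoid.zero_simplifying
      (fun h => hc (P.lower le_top h)) hd
    have h1 : dom (t * (c : S)) = dom t ⊓ c := dom_mul_coe t c
    have h2 : ran (t * (c : S)) ≤ d := (ran_mul_le _ _).trans htd
    refine ⟨t * c, ?_, ?_, ?_, h2.trans le_sup_right⟩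
    · rw [mul_eq_zero_iff, h1]
      exact hcd.mono inf_le_right h2
    · rw [h1]
      exact fun h => (hP.mem_or_mem h).elim ht hc
    · rw [h1]; exact inf_le_right.trans le_sup_left
  by_cases h : b₁ ∈ P
  · have h' : b₂ ∉ P := fun h' => hb (Order.Ideal.sup_mem h h')
    rw [sup_comm]
    exact key h' h₁ hd.symm
  · exact key h h₂ hd

/-- The meet of `g` and `1` is the largest idempotent below `g`. -/
theorem exists_fix (g : S) : ∃ k : Idem S, ∀ e : Idem S, e ≤ k ↔ g * (e : S) = e := by
  obtain ⟨c, hc⟩ := IsTarskiMonoid.exists_meet g 1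
  refine ⟨⟨c, le_one_iff.1 (hc.1 (by simp))⟩, fun e => ?_⟩
  rw [← idem_le_iff e.2]
  constructor
  · intro h
    exact le_trans (Subtype.coe_le_coe.2 h) (hc.1 (by simp))
  · intro h
    refine hc.2 ?_
    rintro _ (rfl | rfl)
    · exact h
    · exact coe_le_one e

/-- The support of an element, the complement of its largest idempotent of fixed points. -/
noncomputable def support (g : S) : Idem S := (Classical.choose (exists_fix g))ᶜ

theorem disjoint_support_iff {g : S} {e : Idem S} :
    Disjoint e (support g) ↔ g * (e : S) = e := by
  rw [support, disjoint_compl_right_iff]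
  exact Classical.choose_spec (exists_fix g) e

theorem support_le_iff {g : S} {b : Idem S} :
    support g ≤ b ↔ g * ((bᶜ : Idem S) : S) = ((bᶜ : Idem S) : S) := by
  rw [← disjoint_support_iff, disjoint_compl_left_iff]

/-- If nothing nonzero below `b` is moved off itself, every `c ≤ b` is fixed: both differences
between `c` and its image yield displaced elements. Then `g * b` commutes with all idempotents, so
by fundamentality it is idempotent and equals `b`. -/
theorem exists_disjoint_of_not_disjoint_support {g : Sˣ} {b : Idem S}
    (h : ¬ Disjoint b (support (g : S))) :
    ∃ c ≤ b, c ≠ ⊥ ∧ Disjoint (conj (g : S) c) c := by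
  by_contra! H
  apply h
  rw [disjoint_support_iff]
  have fix : ∀ c ≤ b, conj (g : S) c = c := by
    intro c hc
    apply le_antisymm
    · rw [← sdiff_eq_bot_iff]
      by_contra h0
      have hle : conj ((g⁻¹ : Sˣ) : S) (conj (g : S) c \ c) ≤ c := by
        conv_rhs => rw [← conj_units_inv_conj g c]
        exact conj_mono _ sdiff_le
      refine H _ (hle.trans hc) ?_ ?_
      · intro h1
        apply h0
        rw [← conj_units_conj_inv g (_ \ _), h1, conj_bot]
      · rw [conj_units_conj_inv]
        exact disjoint_sdiff_self_left.mono_right hle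
    · rw [← sdiff_eq_bot_iff]
      by_contra h0
      exact H _ (sdiff_le.trans hc) h0
        (disjoint_sdiff_self_right.mono_left (conj_mono _ sdiff_le))
  have hi : IsIdempotentElem ((g : S) * (b : S)) := by
    apply IsSimpleTarskiMonoid.fundamental
    intro e he
    obtain ⟨e, rfl⟩ : ∃ e' : Idem S, (e' : S) = e := ⟨⟨e, he⟩, rfl⟩
    have h1 := mul_coe (g : S) (b ⊓ e)
    rw [fix _ inf_le_left, coe_inf, ← mul_assoc] at h1
    rw [h1, mul_coe (g : S) b, fix b le_rfl, ← mul_assoc, coe_comm]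
  have h1 := dom_coe (⟨_, hi⟩ : Idem S)
  change dom ((g : S) * (b : S)) = _ at h1
  rw [dom_mul_coe, dom_units, top_inf_eq] at h1
  exact (congrArg Subtype.val h1).symm

theorem exists_restrict {τ : Sˣ} {a : Idem S} (hτ : τ * τ = 1)
    (ha : Disjoint (conj (τ : S) a) a) :
    ∃ σ ∈ Sym S, (∀ c ≤ a ⊔ conj (τ : S) a, conj (σ : S) c = conj (τ : S) c) ∧
      ∀ c, Disjoint c (a ⊔ conj (τ : S) a) → conj (σ : S) c = c := by
  by_cases ha0 : a = ⊥
  · subst ha0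
    refine ⟨1, one_mem _, fun c hc => ?_, fun c _ => conj_one c⟩
    rw [conj_bot, sup_bot_eq, le_bot_iff] at hc
    rw [hc, conj_bot, conj_bot]
  have hd : dom ((τ : S) * (a : S)) = a := by rw [dom_mul_coe, dom_units, top_inf_eq]
  have hr : ran ((τ : S) * (a : S)) = conj (τ : S) a := ran_mul_coe _ _
  have hxτ : (τ : S) * (a : S) ≤ τ := mul_idem_le _ a.2
  have hxτ' : ((τ : S) * (a : S))⁻¹ ≤ τ := by
    have := inverse_le_inverse hxτ
    rwa [← coe_units_inv, inv_eq_of_mul_eq_one_left hτ] at this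
  obtain ⟨σ, hσ, -, h1, h2, h3⟩ := exists_specialInvolution (a := (τ : S) * (a : S))
    (fun h => ha0 (by rw [← hd, h, dom_eq_bot_iff]))
    (by rw [mul_eq_zero_iff, hd, hr]; exact ha.symm)
  have h4 : (σ : S) * ((a ⊔ conj (τ : S) a : Idem S) : S) =
      (τ : S) * ((a ⊔ conj (τ : S) a : Idem S) : S) := by
    apply eq_on_sup
    · rw [hd] at h1; exact h1
    · rw [← mul_dom_of_le hxτ', dom_inverse, hr] at h2
      exact h2
  rw [hd, hr] at h3
  refine ⟨σ, Subgroup.subset_closure hσ, fun c hc => conj_congr (mul_coe_congr h4 hc),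
    fun c hc => ?_⟩
  rw [← le_compl_iff_disjoint_right] at hc
  have := conj_congr (mul_coe_congr (t := 1) (by rw [h3, one_mul]) hc)
  rwa [conj_one] at this

theorem exists_sq_zero {b : Idem S} (hb : b ≠ ⊥) :
    ∃ a : S, a ≠ 0 ∧ a * a = 0 ∧ dom a ≤ b ∧ ran a ≤ b := by
  obtain ⟨P, hP, -, hbP⟩ := Order.Ideal.exists_isPrime_of_notMem
    (J := Order.Ideal.principal (⊥ : Idem S)) (b := b) (fun h => hb (le_bot_iff.1 h))
  obtain ⟨a, h1, h2, h3⟩ := exists_sq_zero_of_isPrime hP hbP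
  exact ⟨a, fun h => h2 (by rw [h, dom_eq_bot_iff.2 rfl]; exact P.bot_mem), h1, h3⟩

/-- With `τ` exchanging `dom a` and `ran a`, and `σ` exchanging two disjoint pieces `dom c` and `ran
c` of `ran a`, the product `σ * τ` permutes `dom c`, `τ (dom c)`, `ran c`, `τ (ran c)` in a 4-cycle.
-/
theorem exists_sq_ne_one {b : Idem S} (hb : b ≠ ⊥) :
    ∃ g ∈ Sym S, support (g : S) ≤ b ∧ g * g ≠ 1 := by
  obtain ⟨a, ha0, ha, had, har⟩ := exists_sq_zero hb
  have hra : ran a ≠ ⊥ := fun h => ha0 (ran_eq_bot_iff.1 h)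
  obtain ⟨c, hc0, hc, hcd, hcr⟩ := exists_sq_zero hra
  obtain ⟨τ, hτ, hττ, t1, t2, t3⟩ := exists_specialInvolution ha0 ha
  obtain ⟨σ, hσ, -, s1, s2, s3⟩ := exists_specialInvolution hc0 hc
  refine ⟨σ * τ, mul_mem (Subgroup.subset_closure hσ) (Subgroup.subset_closure hτ), ?_, ?_⟩
  · rw [support_le_iff, Units.val_mul, mul_assoc]
    have e1 := mul_coe_congr (t := 1) (by rw [t3, one_mul]) (compl_le_compl (sup_le had har))
    have e2 := mul_coe_congr (t := 1) (by rw [s3, one_mul])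
      (compl_le_compl (sup_le (hcd.trans har) (hcr.trans har)))
    rw [e1, one_mul, e2, one_mul]
  · intro h
    rw [mul_eq_zero_iff] at ha hc
    have hτd : ∀ e ≤ ran a, conj (τ : S) e ≤ dom a := by
      intro e he
      rw [conj_congr (mul_coe_congr (t := a⁻¹) (by rw [t2, ← dom_inverse, mul_dom]) he)]
      simpa using conj_le_ran a⁻¹ e
    have hττ' : ∀ e, conj (τ : S) (conj (τ : S) e) = e := by
      intro e
      rw [← conj_mul, ← Units.val_mul, hττ, Units.val_one, conj_one]
    have hσc : conj (σ : S) (dom c) = ran c := by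
      rw [conj_congr (t := c) (by rw [s1, mul_dom]), conj_dom]
    have hσf : ∀ e ≤ dom a, conj (σ : S) e = e := by
      intro e he
      have hle : e ≤ (dom c ⊔ ran c)ᶜ := by
        rw [le_compl_iff_disjoint_right]
        exact ha.mono he (sup_le hcd hcr)
      rw [conj_congr (mul_coe_congr (t := 1) (by rw [s3, one_mul]) hle), conj_one]
    have h1 := congrArg (fun g : Sˣ => conj (g : S) (conj (τ : S) (dom c))) h
    simp only [Units.val_mul, conj_mul, Units.val_one, conj_one] at h1
    rw [hττ', hσc, hσf _ (hτd _ hcr)] at h1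
    have h2 := congrArg (conj (τ : S)) h1
    rw [hττ', hττ'] at h2
    rw [h2, disjoint_self] at hc
    exact hc0 (dom_eq_bot_iff.1 hc)

/-- A compactness argument: if finitely many involutions supported below `b` cannot cover `b`, a
prime ideal contains everything they do cover but not `b`. Near this point there is `a` of square
zero below `b`, and its involution moves `dom a` off itself, so its support covers `dom a`. -/
theorem exists_sup_support {G : Type*} [Group G] (ι : G →* Sˣ) (hι : Sym S ≤ ι.range)
    (hinj : Function.Injective ι) (b : Idem S) :
    ∃ F : Finset G, (∀ τ ∈ F, τ * τ = 1) ∧ (F.sup fun g => support (ι g : S)) = b := by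
  classical
  let J : Order.Ideal (Idem S) :=
    { carrier := {e | ∃ F : Finset G, (∀ τ ∈ F, τ * τ = 1 ∧ support (ι τ : S) ≤ b) ∧
        e ≤ F.sup fun g => support (ι g : S)}
      lower' := by
        rintro x y hyx ⟨F, hF, hx⟩
        exact ⟨F, hF, hyx.trans hx⟩
      nonempty' := ⟨⊥, ∅, by simp, bot_le⟩
      directed' := by
        rintro x ⟨F, hF, hx⟩ y ⟨K, hK, hy⟩
        refine ⟨x ⊔ y, ⟨F ∪ K, fun τ hτ => ?_, ?_⟩, le_sup_left, le_sup_right⟩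
        · exact (Finset.mem_union.1 hτ).elim (hF τ) (hK τ)
        · rw [Finset.sup_union]
          exact sup_le_sup hx hy }
  have hb : b ∈ J := by
    by_contra hb
    obtain ⟨P, hP, hJP, hbP⟩ := Order.Ideal.exists_isPrime_of_notMem hb
    obtain ⟨a, ha, haP, had, har⟩ := exists_sq_zero_of_isPrime hP hbP
    have ha0 : a ≠ 0 := fun h => haP (by rw [h, dom_eq_bot_iff.2 rfl]; exact P.bot_mem)
    obtain ⟨g, hg, hgg, g1, -, g3⟩ := exists_specialInvolution ha0 ha
    obtain ⟨γ, rfl⟩ := hι (Subgroup.subset_closure hg)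
    rw [← map_mul, ← map_one ι] at hgg
    apply haP
    apply hJP
    refine ⟨{γ}, ?_, ?_⟩
    · simp only [Finset.mem_singleton, forall_eq]
      exact ⟨hinj hgg, (support_le_iff.2 g3).trans (sup_le had har)⟩
    · rw [Finset.sup_singleton, ← disjoint_compl_right_iff, disjoint_iff]
      have h1 : (ι γ : S) * ((dom a ⊓ (support (ι γ : S))ᶜ : Idem S) : S) =
          ((dom a ⊓ (support (ι γ : S))ᶜ : Idem S) : S) :=
        disjoint_support_iff.1 (disjoint_compl_left.mono_left inf_le_right)
      have h2 := conj_congr (t := 1) (h1.trans (one_mul _).symm)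
      rw [conj_one, conj_congr (mul_coe_congr (t := a) (by rw [g1, mul_dom]) inf_le_left)] at h2
      rw [mul_eq_zero_iff] at ha
      rw [← le_bot_iff, ← ha.eq_bot]
      exact le_inf inf_le_left (h2 ▸ conj_le_ran _ _)
  obtain ⟨F, hF, hle⟩ := hb
  exact ⟨F, fun τ hτ => (hF τ hτ).1, le_antisymm (Finset.sup_le fun τ hτ => (hF τ hτ).2) hle⟩

/-- A group of units containing all special involutions acts on the idempotents with supports. -/
noncomputable def supportedAction {G : Type*} [Group G] (ι : G →* Sˣ)
    (hinj : Function.Injective ι) (hι : Sym S ≤ ι.range) : SupportedAction G (Idem S) where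
  act := unitsConj.comp ι
  supp g := support (ι g : S)
  injective g h hgh := by
    apply hinj
    apply Units.ext
    exact eq_of_conj_eq IsSimpleTarskiMonoid.fundamental fun e => DFunLike.congr_fun hgh e
  act_eq_self {g b} h := by
    change conj (ι g : S) b = b
    rw [conj_congr (t := 1) (by rw [disjoint_support_iff.1 h, one_mul]), conj_one]
  exists_disjoint h := exists_disjoint_of_not_disjoint_support h
  exists_sq_ne_one hb := by
    obtain ⟨g, hg, h1, h2⟩ := exists_sq_ne_one hb
    obtain ⟨γ, rfl⟩ := hι hg
    exact ⟨γ, h1, fun h => h2 (by rw [← map_mul, h, map_one])⟩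
  exists_restrict {τ a} hτ ha := by
    obtain ⟨g, hg, h1, h2⟩ := exists_restrict (τ := ι τ) (by rw [← map_mul, hτ, map_one]) ha
    obtain ⟨γ, rfl⟩ := hι hg
    exact ⟨γ, h1, h2⟩
  exists_sup_supp := exists_sup_support ι hι hinj

end Simple

end InverseMonoidWithZero

namespace InverseMonoidWithZero

/-! ### Generation by idempotents and elements of square zero -/

section Generation

variable {S : Type u} [InverseMonoidWithZero S]

theorem conj_coe [IsBooleanInverseMonoid S] (e f : Idem S) : conj (e : S) f = e ⊓ f := by
  apply Subtype.ext
  rw [coe_conj, coe_inf, idem_inverse, coe_comm, mul_assoc, idem_mul_self]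

theorem disjoint_conj [IsBooleanInverseMonoid S] (s : S) {e f : Idem S} (h : Disjoint e f) :
    Disjoint (conj s e) (conj s f) := by
  rw [disjoint_iff_mul_eq_zero] at h ⊢
  calc s * (e : S) * s⁻¹ * (s * f * s⁻¹) = s * (e * (dom s : S)) * f * s⁻¹ := by
        simp [mul_assoc]
    _ = s * (dom s : S) * (e * f) * s⁻¹ := by rw [coe_comm]; simp only [mul_assoc]
    _ = 0 := by rw [h, mul_zero, zero_mul]

theorem compatible_mul_coe (s : S) (e f : Idem S) : Compatible (s * (e : S)) (s * (f : S)) := by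
  constructor
  · have h : (s * (e : S))⁻¹ * (s * f) = e * (dom s : S) * f := by simp [mul_assoc]
    rw [h]
    exact idem_mul (idem_mul e.2 (dom s).2) f.2
  · have h : s * (e : S) * (s * (f : S))⁻¹ = s * (e * f) * s⁻¹ := by simp [mul_assoc]
    rw [h]
    exact conj_idem s (idem_mul e.2 f.2)

theorem Compatible.inverse {a b : S} (h : Compatible a b) : Compatible a⁻¹ b⁻¹ :=
  ⟨by rw [inverse_inverse]; exact h.2, by rw [inverse_inverse]; exact h.1⟩

/-- Multiplying the join by `e` on the right and passing to inverses turns ranges into domains,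
whose joins are known. -/
theorem conj_of_isLUB [IsBooleanInverseMonoid S] {a b c : S} (hab : Compatible a b)
    (h : IsLUB {a, b} c) (e : Idem S) : conj c e = conj a e ⊔ conj b e := by
  have := isLUB_inverse (IsBooleanInverseMonoid.join_mul (e : S) a b c hab h)
  rw [Set.image_pair] at this
  have := dom_sup_of_isLUB this
  rwa [dom_inverse, dom_inverse, dom_inverse, ran_mul_coe, ran_mul_coe, ran_mul_coe] at this

/-- A simple Tarski monoid is generated, under products and compatible joins, by its idempotents
and its elements of square zero. -/
theorem mem_of_closed [IsSimpleTarskiMonoid S] (K : Set S)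
    (mul : ∀ a ∈ K, ∀ b ∈ K, a * b ∈ K) (coe : ∀ e : Idem S, (e : S) ∈ K)
    (sq : ∀ a, a * a = 0 → a ∈ K)
    (join : ∀ a ∈ K, ∀ b ∈ K, ∀ c, Compatible a b → IsLUB {a, b} c → c ∈ K) (s : S) : s ∈ K := by
  let J : Order.Ideal (Idem S) :=
    { carrier := {e | s * (e : S) ∈ K}
      lower' := by
        intro e e' h he
        change s * (e' : S) ∈ K
        rw [← idem_le_iff'.1 h, ← mul_assoc]
        exact mul _ he _ (coe e')
      nonempty' := ⟨⊥, by
        change s * (0 : S) ∈ K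
        rw [mul_zero]; exact coe ⊥⟩
      directed' := by
        intro e he e' he'
        exact ⟨e ⊔ e', join _ he _ he' _ (compatible_mul_coe s e e') (isLUB_mul_sup s e e'),
          le_sup_left, le_sup_right⟩ }
  suffices h : ⊤ ∈ J by
    have h' : s * ((⊤ : Idem S) : S) ∈ K := h
    rwa [coe_top, mul_one] at h'
  by_contra hJ
  obtain ⟨P, hP, hJP, htop⟩ := Order.Ideal.exists_isPrime_of_notMem hJ
  have mem_compl : ∀ e ∈ P, eᶜ ∉ P := fun e he he' =>
    htop (sup_compl_eq_top (x := e) ▸ Order.Ideal.sup_mem he he')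
  have hs : dom s ∉ P := by
    have : (dom s)ᶜ ∈ J := by
      change s * (((dom s)ᶜ : Idem S) : S) ∈ K
      rw [mul_eq_zero_iff.2 (by rw [ran_coe]; exact disjoint_compl_right)]
      exact coe ⊥
    have := mem_compl _ (hJP this)
    rwa [compl_compl] at this
  have mem_or : ∀ {x y : Idem S}, Disjoint x y → x ∈ P ∨ y ∈ P := fun h =>
    hP.mem_or_mem (by rw [disjoint_iff.1 h]; exact P.bot_mem)
  -- The idempotent `f` must avoid both the point `P` and its image under `s`. Of three pairwise
  -- disjoint nonzero idempotents each of these points meets at most one, so one of the three avoids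
  -- both.
  obtain ⟨f, hf0, hf, hf'⟩ : ∃ f : Idem S, f ≠ ⊥ ∧ f ∈ P ∧ conj s⁻¹ f ∈ P := by
    obtain ⟨x, w, hx, hw, hxw, -⟩ := exists_split fun h : (⊤ : Idem S) = ⊥ => htop (h ▸ P.bot_mem)
    obtain ⟨y, z, hy, hz, hyz, rfl⟩ := exists_split hw
    have hxy : Disjoint x y := hxw.mono_right le_sup_left
    have hxz : Disjoint x z := hxw.mono_right le_sup_right
    have h1 := mem_or hxy
    have h2 := mem_or hxz
    have h3 := mem_or hyz
    have h4 := mem_or (disjoint_conj s⁻¹ hxy)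
    have h5 := mem_or (disjoint_conj s⁻¹ hxz)
    have h6 := mem_or (disjoint_conj s⁻¹ hyz)
    by_cases hx' : x ∈ P ∧ conj s⁻¹ x ∈ P
    · exact ⟨x, hx, hx'⟩
    by_cases hy' : y ∈ P ∧ conj s⁻¹ y ∈ P
    · exact ⟨y, hy, hy'⟩
    exact ⟨z, hz, by tauto⟩
  -- Near `P`, `s` factors as `(s * a⁻¹) * a`, where `a` goes into `f` and `s * a⁻¹` leaves it.
  -- Cutting `t` down to lie off `f` and off `conj s⁻¹ f` makes both factors have square zero.
  obtain ⟨t, ht, htf⟩ := exists_dom_notMem IsSimpleTarskiMonoid.zero_simplifying htop hf0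
  have hda : dom (t * ((dom s ⊓ (fᶜ ⊓ (conj s⁻¹ f)ᶜ) : Idem S) : S)) =
      dom t ⊓ (dom s ⊓ (fᶜ ⊓ (conj s⁻¹ f)ᶜ)) := dom_mul_coe _ _
  have hra : ran (t * ((dom s ⊓ (fᶜ ⊓ (conj s⁻¹ f)ᶜ) : Idem S) : S)) ≤ f :=
    (ran_mul_le _ _).trans htf
  generalize t * ((dom s ⊓ (fᶜ ⊓ (conj s⁻¹ f)ᶜ) : Idem S) : S) = a at hda hra
  have haP : dom a ∉ P := by
    rw [hda]
    intro h
    rcases hP.mem_or_mem h with h | h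
    · exact ht h
    rcases hP.mem_or_mem h with h | h
    · exact hs h
    rcases hP.mem_or_mem h with h | h
    · exact mem_compl _ hf h
    · exact mem_compl _ hf' h
  have h1 : dom a ≤ fᶜ := hda.le.trans (inf_le_right.trans (inf_le_right.trans inf_le_left))
  have h2 : dom a ≤ (conj s⁻¹ f)ᶜ :=
    hda.le.trans (inf_le_right.trans (inf_le_right.trans inf_le_right))
  have ha : a * a = 0 := by
    rw [mul_eq_zero_iff]
    exact disjoint_compl_left.mono h1 hra
  have hc : (s * a⁻¹) * (s * a⁻¹) = 0 := by
    have hd : dom (s * a⁻¹) ≤ f := (dom_mul_le _ _).trans ((dom_inverse a).trans_le hra)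
    have hr : ran (s * a⁻¹) = conj s (dom a) := by rw [ran_mul_eq, ran_inverse]
    rw [mul_eq_zero_iff, hr, disjoint_comm, disjoint_iff]
    have h3 := disjoint_iff.1 (disjoint_conj s (le_compl_iff_disjoint_right.1 h2))
    rw [conj_conj_inverse, ← inf_assoc, inf_eq_left.2 (conj_le_ran s (dom a))] at h3
    exact le_bot_iff.1 ((inf_le_inf_left _ hd).trans h3.le)
  apply haP
  apply hJP
  change s * (a⁻¹ * a) ∈ K
  rw [← mul_assoc]
  exact mul _ (sq _ hc) _ (sq _ ha)

end Generation

/-! ### From the algebra isomorphism to the monoid isomorphism -/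

section Realization

variable {S : Type u} {T : Type v} [InverseMonoidWithZero S] [InverseMonoidWithZero T]

/-- The elements `s` and `t` act in the same way on the idempotents, these being identified by
means of `α`. -/
def Corresponds (α : Idem S ≃o Idem T) (s : S) (t : T) : Prop :=
  (∀ e, α (conj s e) = conj t (α e)) ∧ ∀ e, α (conj s⁻¹ e) = conj t⁻¹ (α e)

variable {α : Idem S ≃o Idem T}

theorem Corresponds.symm {s : S} {t : T} (h : Corresponds α s t) : Corresponds α.symm t s := by
  constructor <;> intro e <;> rw [OrderIso.symm_apply_eq]
  · rw [h.1, OrderIso.apply_symm_apply]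
  · rw [h.2, OrderIso.apply_symm_apply]

theorem Corresponds.inverse {s : S} {t : T} (h : Corresponds α s t) :
    Corresponds α s⁻¹ t⁻¹ :=
  ⟨h.2, by simpa using h.1⟩

theorem Corresponds.mul {s s' : S} {t t' : T} (h : Corresponds α s t)
    (h' : Corresponds α s' t') : Corresponds α (s * s') (t * t') := by
  constructor <;> intro e
  · rw [conj_mul, conj_mul, h.1, h'.1]
  · rw [inverse_mul, inverse_mul, conj_mul, conj_mul, h'.2, h.2]

theorem Corresponds.unique (hT : IsFundamental T) {s : S} {t t' : T} (h : Corresponds α s t)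
    (h' : Corresponds α s t') : t = t' := by
  apply eq_of_conj_eq hT
  intro e
  rw [← α.apply_symm_apply e, ← h.1, ← h'.1]

theorem corresponds_coe [IsBooleanInverseMonoid S] [IsBooleanInverseMonoid T]
    (α : Idem S ≃o Idem T) (e : Idem S) : Corresponds α (e : S) (α e : T) := by
  constructor <;> intro x
  · rw [conj_coe, conj_coe, map_inf]
  · rw [idem_inverse, idem_inverse, conj_coe, conj_coe, map_inf]

/-- Compatibility says that two products are idempotent, and by uniqueness the counterpart of an
idempotent is its image under `α`. -/
theorem Corresponds.compatible [IsBooleanInverseMonoid S] [IsBooleanInverseMonoid T]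
    (hT : IsFundamental T) {s s' : S} {t t' : T} (h : Corresponds α s t)
    (h' : Corresponds α s' t') (hs : Compatible s s') : Compatible t t' := by
  have key : ∀ {x : S} {y : T}, IsIdempotentElem x → Corresponds α x y →
      IsIdempotentElem y := by
    intro x y hx hxy
    rw [hxy.unique hT (corresponds_coe α ⟨x, hx⟩)]
    exact (α ⟨x, hx⟩).2
  exact ⟨key hs.1 (h.inverse.mul h'), key hs.2 (h.mul h'.inverse)⟩

theorem Corresponds.exists_of_isLUB [IsBooleanInverseMonoid S] [IsBooleanInverseMonoid T]
    (hT : IsFundamental T) {s s' c : S} {t t' : T} (h : Corresponds α s t)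
    (h' : Corresponds α s' t') (hs : Compatible s s') (hc : IsLUB {s, s'} c) :
    ∃ d, Corresponds α c d := by
  have ht := h.compatible hT h' hs
  obtain ⟨d, hd⟩ := IsBooleanInverseMonoid.exists_join t t' ht
  have hci := isLUB_inverse hc
  have hdi := isLUB_inverse hd
  rw [Set.image_pair] at hci hdi
  refine ⟨d, fun e => ?_, fun e => ?_⟩
  · rw [conj_of_isLUB hs hc, conj_of_isLUB ht hd, map_sup, h.1, h'.1]
  · rw [conj_of_isLUB hs.inverse hci, conj_of_isLUB ht.inverse hdi, map_sup, h.2, h'.2]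

variable [IsSimpleTarskiMonoid S] [IsSimpleTarskiMonoid T]
  {G : Type*} {H : Type*} [Group G] [Group H]

/-- The elements with a counterpart satisfy the closure conditions of `mem_of_closed`. A nonzero
element of square zero is `g * dom a` for a special involution `g`, and `g` comes from the group. -/
theorem exists_corresponds (ι : G →* Sˣ) (κ : G →* Tˣ) (hι : Sym S ≤ ι.range)
    (h : ∀ g e, α (conj (ι g : S) e) = conj (κ g : T) (α e)) (s : S) :
    ∃ t, Corresponds α s t := by
  refine mem_of_closed {s | ∃ t, Corresponds α s t} ?_ ?_ ?_ ?_ s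
  · rintro a ⟨x, hx⟩ b ⟨y, hy⟩
    exact ⟨x * y, hx.mul hy⟩
  · exact fun e => ⟨_, corresponds_coe α e⟩
  · intro a ha
    by_cases ha0 : a = 0
    · rw [ha0]
      exact ⟨_, corresponds_coe α ⊥⟩
    obtain ⟨g, hg, -, h1, -⟩ := exists_specialInvolution ha0 ha
    obtain ⟨γ, rfl⟩ := hι (Subgroup.subset_closure hg)
    have hγ : Corresponds α (ι γ : S) (κ γ : T) := by
      refine ⟨h γ, fun e => ?_⟩
      rw [← coe_units_inv, ← coe_units_inv, ← map_inv, ← map_inv]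
      exact h γ⁻¹ e
    rw [← h1]
    exact ⟨_, hγ.mul (corresponds_coe α (dom a))⟩
  · rintro a ⟨x, hx⟩ b ⟨y, hy⟩ c hab hc
    exact hx.exists_of_isLUB IsSimpleTarskiMonoid.fundamental hy hab hc

/-- Isomorphic groups of units containing all special involutions come from isomorphic monoids. -/
theorem nonempty_mulEquiv_of_groups (ι : G →* Sˣ) (hι : Function.Injective ι)
    (hSι : Sym S ≤ ι.range) (κ : H →* Tˣ) (hκ : Function.Injective κ) (hTκ : Sym T ≤ κ.range)
    (f : G ≃* H) : Nonempty (S ≃* T) := by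
  obtain ⟨α, hα⟩ := SupportedAction.exists_equivariant_orderIso
    (supportedAction ι hι hSι) (supportedAction κ hκ hTκ) f
  have hα' : ∀ g e, α (conj (ι g : S) e) = conj (κ (f g) : T) (α e) := hα
  choose F hF using exists_corresponds ι (κ.comp f.toMonoidHom) hSι hα'
  have hsymm : ∀ g e, α.symm (conj (κ g : T) e) = conj (ι (f.symm g) : S) (α.symm e) := by
    intro g e
    rw [OrderIso.symm_apply_eq, hα', f.apply_symm_apply, α.apply_symm_apply]
  have hsurj := exists_corresponds κ (ι.comp f.symm.toMonoidHom) hTκ hsymm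
  have fS : IsFundamental S := IsSimpleTarskiMonoid.fundamental
  have fT : IsFundamental T := IsSimpleTarskiMonoid.fundamental
  refine ⟨MulEquiv.ofBijective
    (⟨F, fun a b => (hF _).unique fT ((hF a).mul (hF b))⟩ : S →ₙ* T)
    ⟨fun a b hab => ?_, fun t => ?_⟩⟩
  · have hab' : F a = F b := hab
    exact (hF a).symm.unique fS (hab' ▸ (hF b).symm)
  · obtain ⟨s, hs⟩ := hsurj t
    exact ⟨s, (hF s).unique fT hs.symm⟩

end Realization

/-! ### Isomorphisms of monoids preserve special involutions -/

section Transport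

variable {S : Type u} {T : Type v} [InverseMonoidWithZero S] [InverseMonoidWithZero T]

theorem map_inverse (θ : S ≃* T) (a : S) : θ a⁻¹ = (θ a)⁻¹ :=
  inv_unique _ _ (by rw [← map_mul, ← map_mul, mul_inv_mul])
    (by rw [← map_mul, ← map_mul, inv_mul_inv])

/-- An isomorphism of inverse monoids preserves the natural partial order. -/
def orderIsoOfMulEquiv (θ : S ≃* T) : S ≃o T where
  toEquiv := θ.toEquiv
  map_rel_iff' {a b} := by
    change θ a = θ b * (θ a)⁻¹ * θ a ↔ a = b * a⁻¹ * a
    rw [← map_inverse, ← map_mul, ← map_mul, θ.injective.eq_iff]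

theorem isLUB_map (θ : S ≃* T) {X : Set S} {c : S} (h : IsLUB X c) : IsLUB (θ '' X) (θ c) :=
  (orderIsoOfMulEquiv θ).isLUB_image'.2 h

theorem IsSpecialInvolution.map (θ : S ≃* T) {g : Sˣ} (h : IsSpecialInvolution g) :
    IsSpecialInvolution (Units.mapEquiv θ g) := by
  obtain ⟨a, x, f, h0, h2, hx, ⟨hf1, hf2, hf3⟩, hg⟩ := h
  have h2' := congrArg θ h2
  have hx' := isLUB_map θ hx
  have hf3' := isLUB_map θ hf3
  have hg' := isLUB_map θ hg
  have hf2' := congrArg θ hf2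
  simp only [Set.image_insert_eq, Set.image_singleton, map_mul, map_inverse, map_pow, map_zero,
    map_one] at h2' hx' hf3' hg' hf2'
  exact ⟨θ a, θ x, θ f, by simpa using h0, h2', hx', ⟨hf1.map θ, hf2', hf3'⟩, hg'⟩

theorem map_sym_le (θ : S ≃* T) : (Sym S).map (Units.mapEquiv θ).toMonoidHom ≤ Sym T := by
  rw [Sym, MonoidHom.map_closure, Subgroup.closure_le]
  rintro _ ⟨g, hg, rfl⟩
  exact Subgroup.subset_closure (IsSpecialInvolution.map θ hg)

theorem map_sym (θ : S ≃* T) : (Sym S).map (Units.mapEquiv θ).toMonoidHom = Sym T := by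
  refine le_antisymm (map_sym_le θ) fun g hg => ?_
  refine ⟨(Units.mapEquiv θ).symm g, map_sym_le θ.symm ⟨g, hg, rfl⟩, ?_⟩
  exact (Units.mapEquiv θ).apply_symm_apply g

end Transport

end InverseMonoidWithZero

theorem mainTheorem1 {S : Type u} {T : Type v}
    [InverseMonoidWithZero S] [InverseMonoidWithZero T]
    [IsSimpleTarskiMonoid S] [IsSimpleTarskiMonoid T] :
    List.TFAE [
      Nonempty (S ≃* T),
      Nonempty (Sˣ ≃* Tˣ),
      Nonempty (InverseMonoidWithZero.Sym S ≃* InverseMonoidWithZero.Sym T)] := by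
  tfae_have 1 → 2 := fun ⟨θ⟩ => ⟨Units.mapEquiv θ⟩
  tfae_have 1 → 3 := fun ⟨θ⟩ =>
    ⟨((Units.mapEquiv θ).subgroupMap _).trans
      (MulEquiv.subgroupCongr (InverseMonoidWithZero.map_sym θ))⟩
  tfae_have 2 → 1 := fun ⟨f⟩ =>
    InverseMonoidWithZero.nonempty_mulEquiv_of_groups (MonoidHom.id _) (fun _ _ h => h)
      (fun g _ => ⟨g, rfl⟩) (MonoidHom.id _) (fun _ _ h => h) (fun g _ => ⟨g, rfl⟩) f
  tfae_have 3 → 1 := fun ⟨f⟩ =>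
    InverseMonoidWithZero.nonempty_mulEquiv_of_groups (Subgroup.subtype _)
      (Subgroup.subtype_injective _) (Subgroup.range_subtype _).ge (Subgroup.subtype _)
      (Subgroup.subtype_injective _) (Subgroup.range_subtype _).ge f
  tfae_finish
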